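/- Let $k$ be an algebraically closed field of characteristic $0$, and let $(R,\mathfrak m_R)$ be a complete Noetherian local $k$-algebra which is a one-dimensional domain with residue field $R/\mathfrak m_R = k$. Assume that $R$ is Gorenstein, i.e. that $R$ has finite injective dimension as a module over itself, and that its embedding dimension $n=\operatorname{edim}R$ (the minimal number of generators of $\mathfrak m_R$) satisfies $n\ge 6$. Let $x_1\in\mathfrak m_R$ generate a minimal reduction of $\mathfrak m_R$, i.e. $x_1R$ is minimal with respect to inclusion among the ideals $J\subseteq\mathfrak m_R$ with $J\,\mathfrak m_R^r=\mathfrak m_R^{r+1}$ for some $r\ge 0$. Then $R$ is a quotient of $k[[X_1,\dots,X_n]]$. For any surjective $k$-algebra homomorphism $\Phi:k[[X_1,\dots,X_n]]\to R$ with kernel $I=(f_1,\dots,f_m)$, let $$\Omega_R=\operatorname{coker}\Big(R^m\xrightarrow{\;[\Phi(\partial f_j/\partial X_i)]\;}R^n\Big)$$ be the universally finite module of differentials of $R$ over $k$, and let $\tau(\Omega_R)$ be its torsion submodule. If $\mathfrak m_R^6\subseteq x_1R$, then $\tau(\Omega_R)\ne 0$. -/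

import Mathlib

namespace Berger

open CategoryTheory

universe u v

/-- `J` is a reduction of the ideal `I`: `J ⊆ I` and `J I^r = I^(r+1)` for some `r`. -/
def IsReduction {R : Type v} [CommRing R] (J I : Ideal R) : Prop :=
  J ≤ I ∧ ∃ r : ℕ, J * I ^ r = I ^ (r + 1)

/-- `J` is a minimal reduction of `I`: a reduction of `I` that is minimal under inclusion. -/
def IsMinimalReduction {R : Type v} [CommRing R] (J I : Ideal R) : Prop :=
  Minimal (fun J' : Ideal R => IsReduction J' I) J

/-- The Gorenstein property of a Noetherian local ring: `R` has finite injective dimension as a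
module over itself. -/
def IsGorensteinLocal (R : Type v) [CommRing R] [IsLocalRing R] [IsNoetherianRing R] : Prop :=
  injectiveDimension (ModuleCat.of R R) < ⊤

section Differentials

variable {k : Type u} [Field k] {R : Type v} [CommRing R] [Algebra k R] {n : ℕ}

/-- The image `(Φ(∂f/∂X₁), …, Φ(∂f/∂Xₙ))` in `R^n` of the gradient of a power series `f`. -/
noncomputable def gradient (Φ : MvPowerSeries (Fin n) k →ₐ[k] R) (f : MvPowerSeries (Fin n) k) :
    Fin n → R :=
  fun i => Φ (MvPowerSeries.pderiv k i f)

/-- The submodule of `R^n` spanned by the gradients of the elements of `I = ker Φ`. It is the image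
of the Jacobian matrix of any system of generators of `I`, see `jacobianSubmodule_eq_span`. -/
noncomputable def jacobianSubmodule (Φ : MvPowerSeries (Fin n) k →ₐ[k] R) :
    Submodule R (Fin n → R) :=
  Submodule.span R (gradient Φ '' (RingHom.ker Φ : Set (MvPowerSeries (Fin n) k)))

/-- The universally finite module of differentials of `R` over `k`, for a presentation
`Φ : k⟦X₁, …, Xₙ⟧ ↠ R`: the cokernel of the Jacobian matrix of `ker Φ`. -/
abbrev UnivFiniteDifferentials (Φ : MvPowerSeries (Fin n) k →ₐ[k] R) : Type v :=
  (Fin n → R) ⧸ jacobianSubmodule Φ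

/-- The Jacobian submodule is spanned by the gradients of any system of generators of `ker Φ`. -/
theorem jacobianSubmodule_eq_span (Φ : MvPowerSeries (Fin n) k →ₐ[k] R)
    (F : Set (MvPowerSeries (Fin n) k)) (hF : Ideal.span F = RingHom.ker Φ) :
    jacobianSubmodule Φ = Submodule.span R (gradient Φ '' F) := by
  apply le_antisymm
  · refine Submodule.span_le.2 ?_
    rintro _ ⟨f, hf, rfl⟩
    have hf' : f ∈ Ideal.span F := by rw [hF]; exact hf
    refine Submodule.span_induction (p := fun f _ => gradient Φ f ∈ Submodule.span R
      (gradient Φ '' F)) ?_ ?_ ?_ ?_ hf'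
    · exact fun g hg => Submodule.subset_span ⟨g, hg, rfl⟩
    · have h : gradient Φ 0 = 0 := by ext i; simp [gradient]
      rw [h]; exact zero_mem _
    · intro g h _ _ hg hh
      have e : gradient Φ (g + h) = gradient Φ g + gradient Φ h := by ext i; simp [gradient]
      rw [e]; exact add_mem hg hh
    · intro a g hgF hg
      have h0 : Φ g = 0 := hF.le hgF
      have e : gradient Φ (a • g) = Φ a • gradient Φ g := by
        ext i; simp [gradient, Derivation.leibniz, h0]
      rw [e]; exact Submodule.smul_mem _ _ hg
  · refine Submodule.span_mono (Set.image_mono ?_)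
    intro g hg
    change g ∈ RingHom.ker Φ
    rw [← hF]; exact Ideal.subset_span hg

end Differentials

end Berger

/-! Write `P = k⟦X₁, …, Xₙ⟧`, `A = R ⧸ xR = P ⧸ J` with `x = x₁ = Φ ξ`, and `𝔪` for the ideal of the
variables; dimensions are over `k`. The proof compares two estimates for the differentials of `A`.

Upper bound, if `Ω_R` is torsion-free. A derivation of `R` that kills `x` is zero, because `R` is
finite over its constants (`derivation_eq_zero_of_apply_eq_zero`). Hence a functional on `Ω_R` is
determined by its value at `dx`, and `Ω_R` embeds in `R` as an ideal
(`exists_injective_of_dual_determined`). Then `dim Ω_R ⧸ xΩ_R ≤ dim A`, and `Ω_R ⧸ xΩ_R` maps onto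
`Ω_A`, so `dim Ω_A ≤ dim A`.

Lower bound, always (`finrank_quotient_lt_finrank_differentials`). Let `h ≥ n - 1 ≥ 5` be the
embedding dimension of `A`. The kernel of `d : A → Ω_A` lies in `k + 𝔪_A⁴`: symmetry of second
derivatives and the Euler derivation push a closed element into fourth order. The image of `d` is
killed by the exterior derivative at the origin, which maps `Ω_A` onto a space of dimension
`h(h-1)/2`. So `dim Ω_A ≥ dim A - 1 - dim 𝔪_A⁴ + h(h-1)/2`. Since `R` is Gorenstein, `A` has a
nondegenerate trace form (`exists_trace`). Under it `𝔪_A⁴` is orthogonal to `𝔪_A²`, as `𝔪_A⁶ = 0`,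
whence `dim 𝔪_A⁴ ≤ dim A ⧸ 𝔪_A² ≤ 1 + h`. For `h ≥ 5` one has `h(h-1)/2 > h + 2`, so `dim Ω_A > dim
A`, a contradiction. -/

namespace Berger

open MvPowerSeries

/-! ### Power series: the Euler derivation and elements with vanishing differential -/

section PowerSeries

variable {k : Type*} [Field k] {n : ℕ}

/-- The ideal of `k⟦X₁, …, Xₙ⟧` generated by the variables. -/
noncomputable def varIdeal (k : Type*) [Field k] (n : ℕ) : Ideal (MvPowerSeries (Fin n) k) :=
  Ideal.span (Set.range X)

lemma X_mem_varIdeal (i : Fin n) : (X i : MvPowerSeries (Fin n) k) ∈ varIdeal k n :=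
  Ideal.subset_span ⟨i, rfl⟩

/-- The hypothesis says that every monomial of `f` involves a variable from `s`. The induction
splits off the monomials divisible by one variable `X a`. -/
lemma mem_varIdeal_of_coeff_eq_zero (s : Finset (Fin n)) :
    ∀ f : MvPowerSeries (Fin n) k, (∀ d : Fin n →₀ ℕ, (∀ i ∈ s, d i = 0) → coeff d f = 0) →
      f ∈ varIdeal k n := by
  classical
  induction s using Finset.induction_on with
  | empty =>
    intro f hf
    have : f = 0 := by ext d; simpa using hf d (by simp)
    rw [this]; exact zero_mem _
  | insert a s ha ih =>
    intro f hf
    let g : MvPowerSeries (Fin n) k := fun d => if d a = 0 then 0 else coeff d f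
    have hg : ∀ d, coeff d g = if d a = 0 then 0 else coeff d f := fun d => rfl
    have h1 : (X a : MvPowerSeries (Fin n) k) ∣ g := by
      rw [X_dvd_iff]
      intro d hd
      rw [hg, if_pos hd]
    have h2 : f - g ∈ varIdeal k n := by
      refine ih _ fun d hd => ?_
      rw [map_sub, hg]
      split_ifs with h
      · rw [sub_zero]
        refine hf d fun i hi => ?_
        rcases Finset.mem_insert.1 hi with rfl | hi
        · exact h
        · exact hd i hi
      · exact sub_self _
    have h3 := Ideal.mem_of_dvd _ h1 (X_mem_varIdeal (k := k) a)
    simpa using add_mem h2 h3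

lemma mem_varIdeal_iff {f : MvPowerSeries (Fin n) k} :
    f ∈ varIdeal k n ↔ constantCoeff f = 0 := by
  constructor
  · intro hf
    have : varIdeal k n ≤ RingHom.ker (constantCoeff (σ := Fin n) (R := k)) := by
      refine Ideal.span_le.2 ?_
      rintro _ ⟨i, rfl⟩
      simp [RingHom.mem_ker]
    exact this hf
  · intro hf
    refine mem_varIdeal_of_coeff_eq_zero Finset.univ f fun d hd => ?_
    have : d = 0 := by ext i; exact hd i (Finset.mem_univ i)
    rw [this, coeff_zero_eq_constantCoeff_apply, hf]

lemma sub_C_mem_varIdeal (f : MvPowerSeries (Fin n) k) :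
    f - C (constantCoeff f) ∈ varIdeal k n := by
  simp [mem_varIdeal_iff]

lemma pderiv_comm (i j : Fin n) (f : MvPowerSeries (Fin n) k) :
    pderiv k i (pderiv k j f) = pderiv k j (pderiv k i f) := by
  classical
  ext d
  simp only [coeff_pderiv, Finsupp.add_apply]
  rw [add_right_comm d]
  by_cases h : i = j
  · subst h; rfl
  · rw [Finsupp.single_eq_of_ne h, Finsupp.single_eq_of_ne (Ne.symm h)]
    push_cast; ring

/-- The Euler derivation `f ↦ ∑ Xᵢ ∂f/∂Xᵢ`. -/
noncomputable def euler (k : Type*) [Field k] (n : ℕ) :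
    Derivation k (MvPowerSeries (Fin n) k) (MvPowerSeries (Fin n) k) :=
  ∑ i, (X i : MvPowerSeries (Fin n) k) • pderiv k i

lemma euler_apply (f : MvPowerSeries (Fin n) k) :
    euler k n f = ∑ i, X i * pderiv k i f := by
  change Derivation.coeFnAddMonoidHom (euler k n) f = _
  rw [euler, map_sum, Finset.sum_apply]
  rfl

lemma euler_X (i : Fin n) : euler k n (X i) = X i := by
  classical
  rw [euler_apply, Finset.sum_eq_single i]
  · simp
  · intro j _ hj; rw [pderiv_X_of_ne (Ne.symm hj), mul_zero]
  · simp

lemma euler_mem_of_pderiv_mem {K : Ideal (MvPowerSeries (Fin n) k)}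
    {f : MvPowerSeries (Fin n) k} (h : ∀ i, pderiv k i f ∈ K) : euler k n f ∈ varIdeal k n * K := by
  rw [euler_apply]
  exact sum_mem fun i _ => Ideal.mul_mem_mul (X_mem_varIdeal i) (h i)

lemma euler_mem {K : Ideal (MvPowerSeries (Fin n) k)}
    {f : MvPowerSeries (Fin n) k} (h : ∀ i, pderiv k i f ∈ K) : euler k n f ∈ K := by
  rw [euler_apply]
  exact sum_mem fun i _ => Ideal.mul_mem_left _ _ (h i)

lemma euler_mem_varIdeal (f : MvPowerSeries (Fin n) k) : euler k n f ∈ varIdeal k n := by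
  simpa using euler_mem_of_pderiv_mem (K := ⊤) (f := f) (by simp)

lemma euler_sub_mem_sq {f : MvPowerSeries (Fin n) k} (hf : f ∈ varIdeal k n) :
    euler k n f - f ∈ varIdeal k n ^ 2 := by
  refine Submodule.span_induction (p := fun f _ => euler k n f - f ∈ varIdeal k n ^ 2)
    ?_ ?_ ?_ ?_ hf
  · rintro _ ⟨i, rfl⟩
    simp [euler_X]
  · simp
  · intro a b _ _ ha hb
    rw [map_add, add_sub_add_comm]; exact add_mem ha hb
  · intro p a hX ha
    have : euler k n (p • a) - p • a = p * (euler k n a - a) + a * euler k n p := by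
      simp [Derivation.leibniz]; ring
    rw [this]
    refine add_mem (Ideal.mul_mem_left _ _ ha) ?_
    rw [sq]; exact Ideal.mul_mem_mul hX (euler_mem_varIdeal p)

/-- The Euler derivation acts on `𝔪^q ⧸ 𝔪^(q+1)` as multiplication by the degree `q`. -/
lemma euler_sub_mem_pow (q : ℕ) : ∀ f ∈ varIdeal k n ^ q,
    euler k n f - (q : k) • f ∈ varIdeal k n ^ (q + 1) := by
  induction q with
  | zero => intro f _; simpa using euler_mem_varIdeal f
  | succ q ih =>
    intro f hf
    rw [pow_succ'] at hf
    refine Submodule.mul_induction_on hf ?_ ?_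
    · intro a ha b hb
      have : euler k n (a * b) - ((q + 1 : ℕ) : k) • (a * b) =
          a * (euler k n b - (q : k) • b) + (euler k n a - a) * b := by
        simp [Derivation.leibniz, smul_eq_C_mul]; ring
      rw [this]
      refine add_mem ?_ ?_
      · rw [pow_succ' _ (q + 1)]; exact Ideal.mul_mem_mul ha (ih b hb)
      · rw [show q + 1 + 1 = 2 + q by ring, pow_add]
        exact Ideal.mul_mem_mul (euler_sub_mem_sq ha) hb
    · intro a b ha hb
      rw [map_add, smul_add, add_sub_add_comm]; exact add_mem ha hb

lemma pderiv_mem_of_mem_sq {f : MvPowerSeries (Fin n) k} (hf : f ∈ varIdeal k n ^ 2)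
    (i : Fin n) : pderiv k i f ∈ varIdeal k n := by
  rw [sq] at hf
  refine Submodule.mul_induction_on hf ?_ ?_
  · intro a ha b hb
    rw [Derivation.leibniz]
    exact add_mem (Ideal.mul_mem_right _ _ ha) (Ideal.mul_mem_right _ _ hb)
  · intro a b ha hb; rw [map_add]; exact add_mem ha hb

/-- The Euler derivative of `f` lies in `𝔪^(q+1)` and agrees with `j f` modulo `𝔪^(j+1)` when `f ∈
𝔪^j`. Dividing by `j ≠ 0` raises the order of `f` one step at a time. -/
lemma mem_pow_of_pderiv_mem_pow [CharZero k] {q : ℕ} {f : MvPowerSeries (Fin n) k}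
    (h0 : f ∈ varIdeal k n) (h : ∀ i, pderiv k i f ∈ varIdeal k n ^ q) :
    f ∈ varIdeal k n ^ (q + 1) := by
  have hE : euler k n f ∈ varIdeal k n ^ (q + 1) := by
    rw [pow_succ']; exact euler_mem_of_pderiv_mem h
  suffices ∀ j ≤ q, f ∈ varIdeal k n ^ (j + 1) from this q le_rfl
  intro j
  induction j with
  | zero => intro _; simpa using h0
  | succ j ih =>
    intro hj
    have h1 := euler_sub_mem_pow _ f (ih (by omega))
    have h2 : ((j + 1 : ℕ) : k) • f ∈ varIdeal k n ^ (j + 1 + 1) := by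
      have := sub_mem (Ideal.pow_le_pow_right (by omega : j + 1 + 1 ≤ q + 1) hE) h1
      simpa using this
    have h3 : ((j + 1 : ℕ) : k) ≠ 0 := Nat.cast_ne_zero.2 (by omega)
    rw [smul_eq_C_mul] at h2
    have h4 := Ideal.mul_mem_left _ (C (((j + 1 : ℕ) : k)⁻¹)) h2
    rwa [← mul_assoc, ← map_mul, inv_mul_cancel₀ h3, map_one, one_mul] at h4

/-- The gradient of a power series at the origin. -/
noncomputable def gradZero (k : Type*) [Field k] (n : ℕ) :
    MvPowerSeries (Fin n) k →ₗ[k] (Fin n → k) where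
  toFun f i := constantCoeff (pderiv k i f)
  map_add' f g := by ext i; simp
  map_smul' c f := by ext i; simp

lemma gradZero_apply (f : MvPowerSeries (Fin n) k) (i : Fin n) :
    gradZero k n f i = constantCoeff (pderiv k i f) := rfl

lemma gradZero_mul (f g : MvPowerSeries (Fin n) k) :
    gradZero k n (f * g) = constantCoeff f • gradZero k n g + constantCoeff g • gradZero k n f := by
  ext i
  simp [gradZero_apply, Derivation.leibniz]

lemma gradZero_eq_zero_of_mem_sq {f : MvPowerSeries (Fin n) k} (hf : f ∈ varIdeal k n ^ 2) :
    gradZero k n f = 0 := by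
  ext i; exact mem_varIdeal_iff.1 (pderiv_mem_of_mem_sq hf i)

lemma mem_sq_of_gradZero_eq_zero [CharZero k] {f : MvPowerSeries (Fin n) k}
    (h0 : f ∈ varIdeal k n) (h : gradZero k n f = 0) : f ∈ varIdeal k n ^ 2 := by
  refine mem_pow_of_pderiv_mem_pow h0 fun i => ?_
  rw [pow_one]; exact mem_varIdeal_iff.2 (congrFun h i)

lemma gradZero_X (i : Fin n) : gradZero k n (X i) = Pi.single i 1 := by
  classical
  ext j
  rw [gradZero_apply, pderiv_X]
  by_cases h : j = i
  · subst h; simp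
  · rw [Pi.single_eq_of_ne h, Pi.single_eq_of_ne (Ne.symm h), map_zero]

/-- The gradient map `f ↦ (∂f/∂X₁, …, ∂f/∂Xₙ)`. -/
noncomputable def grad (k : Type*) [Field k] (n : ℕ) :
    MvPowerSeries (Fin n) k →ₗ[k] (Fin n → MvPowerSeries (Fin n) k) :=
  LinearMap.pi fun i => (pderiv k i).toLinearMap

@[simp]
lemma grad_apply (f : MvPowerSeries (Fin n) k) (i : Fin n) : grad k n f i = pderiv k i f := rfl

/-- The submodule `J Pⁿ + ∑ P grad g`, `g ∈ J`, of `Pⁿ`, for `P = k⟦X₁, …, Xₙ⟧`; the quotient is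
the module of differentials of `P ⧸ J`. -/
noncomputable def diffRel (J : Ideal (MvPowerSeries (Fin n) k)) :
    Submodule (MvPowerSeries (Fin n) k) (Fin n → MvPowerSeries (Fin n) k) :=
  Submodule.span _ (grad k n '' J) ⊔ Submodule.pi Set.univ fun _ => J

/-- Since `p grad g = grad (p g) - g grad p` with `g ∈ J`, the gradients of elements of `J` already
form a `P`-submodule modulo `J Pⁿ`, so a single `g` suffices. -/
lemma exists_grad_of_mem_diffRel {J : Ideal (MvPowerSeries (Fin n) k)}
    {v : Fin n → MvPowerSeries (Fin n) k} (hv : v ∈ diffRel J) :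
    ∃ g ∈ J, ∀ i, v i - pderiv k i g ∈ J := by
  obtain ⟨a, ha, b, hb, rfl⟩ := Submodule.mem_sup.1 hv
  suffices ∃ g ∈ J, ∀ i, a i - pderiv k i g ∈ J by
    obtain ⟨g, hg, h⟩ := this
    refine ⟨g, hg, fun i => ?_⟩
    have := add_mem (h i) (hb i trivial)
    convert this using 1
    simp only [Pi.add_apply]; ring
  refine Submodule.span_induction (p := fun a _ => ∃ g ∈ J, ∀ i, a i - pderiv k i g ∈ J)
    ?_ ?_ ?_ ?_ ha
  · rintro _ ⟨g, hg, rfl⟩; exact ⟨g, hg, by simp⟩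
  · exact ⟨0, zero_mem _, by simp⟩
  · rintro a b _ _ ⟨g, hg, h⟩ ⟨g', hg', h'⟩
    refine ⟨g + g', add_mem hg hg', fun i => ?_⟩
    rw [map_add, Pi.add_apply, add_sub_add_comm]
    exact add_mem (h i) (h' i)
  · rintro p a _ ⟨g, hg, h⟩
    refine ⟨p * g, Ideal.mul_mem_left _ _ hg, fun i => ?_⟩
    have : (p • a) i - pderiv k i (p * g) = p * (a i - pderiv k i g) - g * pderiv k i p := by
      simp [Derivation.leibniz]; ring
    rw [this]
    exact sub_mem (Ideal.mul_mem_left _ _ (h i)) (Ideal.mul_mem_right _ _ hg)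

lemma exists_sub_smul_mem_sq {J : Ideal (MvPowerSeries (Fin n) k)} {ξ : MvPowerSeries (Fin n) k}
    (hξ : ξ ∈ varIdeal k n) (hJ : J ≤ Ideal.span {ξ} ⊔ varIdeal k n ^ 2)
    {g : MvPowerSeries (Fin n) k} (hg : g ∈ J) : ∃ c : k, g - c • ξ ∈ varIdeal k n ^ 2 := by
  obtain ⟨a, ha, b, hb, rfl⟩ := Submodule.mem_sup.1 (hJ hg)
  obtain ⟨p, rfl⟩ := Ideal.mem_span_singleton'.1 ha
  refine ⟨constantCoeff p, ?_⟩
  have : p * ξ + b - constantCoeff p • ξ = (p - C (constantCoeff p)) * ξ + b := by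
    rw [smul_eq_C_mul]; ring
  rw [this]
  refine add_mem ?_ hb
  rw [sq]; exact Ideal.mul_mem_mul (sub_C_mem_varIdeal p) hξ

lemma exists_eq_smul_of_symm {ℓ c : Fin n → k} (h : ∀ i j, c i * ℓ j = c j * ℓ i) (hℓ : ℓ ≠ 0) :
    ∃ a : k, c = a • ℓ := by
  obtain ⟨p, hp⟩ := Function.ne_iff.1 hℓ
  refine ⟨c p / ℓ p, funext fun i => ?_⟩
  have hp' : ℓ p ≠ 0 := hp
  simp only [Pi.smul_apply, smul_eq_mul]
  field_simp
  exact h i p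

lemma mem_of_smul_mem {K : Ideal (MvPowerSeries (Fin n) k)} {c : k} (hc : c ≠ 0)
    {f : MvPowerSeries (Fin n) k} (h : c • f ∈ K) : f ∈ K := by
  rw [smul_eq_C_mul] at h
  have := Ideal.mul_mem_left _ (C c⁻¹) h
  rwa [← mul_assoc, ← map_mul, inv_mul_cancel₀ hc, map_one, one_mul] at this

/-- Modulo `𝔪²` each `∂ᵢf` is `cᵢ ξ`. Symmetry of the Hessian at the origin makes `c` proportional
to the gradient of `ξ` there, so a multiple of `ξ²` removes all the linear parts at once. -/
lemma exists_pderiv_sub_mem_sq [CharZero k] {J : Ideal (MvPowerSeries (Fin n) k)}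
    {ξ : MvPowerSeries (Fin n) k} (hξ : ξ ∈ varIdeal k n) (hξJ : ξ ∈ J)
    (hJ : J ≤ Ideal.span {ξ} ⊔ varIdeal k n ^ 2) {f : MvPowerSeries (Fin n) k}
    (hf : ∀ i, pderiv k i f ∈ J) :
    ∃ u ∈ J, (∀ i, pderiv k i (f - u) ∈ J) ∧ ∀ i, pderiv k i (f - u) ∈ varIdeal k n ^ 2 := by
  choose c hc using fun i => exists_sub_smul_mem_sq hξ hJ (hf i)
  by_cases hℓ : gradZero k n ξ = 0
  · refine ⟨0, zero_mem _, by simpa using hf, fun i => ?_⟩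
    have := mem_sq_of_gradZero_eq_zero hξ hℓ
    have h := add_mem (hc i) (Ideal.mul_mem_left _ (C (c i)) this)
    rw [← smul_eq_C_mul, sub_add_cancel] at h
    rwa [sub_zero]
  have hsymm : ∀ i j, c i * gradZero k n ξ j = c j * gradZero k n ξ i := by
    have key : ∀ i j, constantCoeff (pderiv k j (pderiv k i f)) = c i * gradZero k n ξ j := by
      intro i j
      have := congrFun (gradZero_eq_zero_of_mem_sq (hc i)) j
      rw [map_sub, map_smul, Pi.sub_apply, Pi.smul_apply, smul_eq_mul, Pi.zero_apply,
        sub_eq_zero] at this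
      exact this
    intro i j
    rw [← key, ← key, pderiv_comm]
  obtain ⟨a, ha⟩ := exists_eq_smul_of_symm hsymm hℓ
  -- The gradient of `b ξ²` is `2b ξ grad ξ`, hence the halving.
  obtain ⟨b, rfl⟩ : ∃ b, a = b + b := ⟨a / 2, by ring⟩
  have hder : ∀ i, pderiv k i (C b * (ξ * ξ)) = (C b + C b) * pderiv k i ξ * ξ := by
    intro i
    rw [Derivation.leibniz, Derivation.leibniz, pderiv_C]
    simp only [smul_eq_mul]; ring
  refine ⟨C b * (ξ * ξ), Ideal.mul_mem_left _ _ (Ideal.mul_mem_left _ _ hξJ),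
    fun i => ?_, fun i => ?_⟩
  · rw [map_sub, hder]
    exact sub_mem (hf i) (Ideal.mul_mem_left _ _ hξJ)
  · have hci : c i • ξ = (C b + C b) * C (constantCoeff (pderiv k i ξ)) * ξ := by
      rw [ha, Pi.smul_apply, smul_eq_mul, smul_eq_C_mul, gradZero_apply, map_mul, map_add]
    have : pderiv k i f - (C b + C b) * pderiv k i ξ * ξ = (pderiv k i f - c i • ξ)
          - (C b + C b) * ((pderiv k i ξ - C (constantCoeff (pderiv k i ξ))) * ξ) := by
      rw [hci]; ring
    rw [map_sub, hder, this]
    refine sub_mem (hc i) (Ideal.mul_mem_left _ _ ?_)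
    rw [sq]; exact Ideal.mul_mem_mul (sub_C_mem_varIdeal _) hξ

lemma mem_sup_pow_succ_of_euler_mem [CharZero k] {J : Ideal (MvPowerSeries (Fin n) k)} {q : ℕ}
    (hq : q ≠ 0) {f : MvPowerSeries (Fin n) k} (hf : f ∈ varIdeal k n ^ q)
    (hE : euler k n f ∈ J) : f ∈ J ⊔ varIdeal k n ^ (q + 1) := by
  have hq' : (q : k) ≠ 0 := Nat.cast_ne_zero.2 hq
  refine mem_of_smul_mem hq' ?_
  have := sub_mem (Ideal.mem_sup_left (T := varIdeal k n ^ (q + 1)) hE)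
    (Ideal.mem_sup_right (S := J) (euler_sub_mem_pow q f hf))
  rwa [sub_sub_cancel] at this

/-- A power series without constant term whose differential vanishes modulo `J` lies in
`J + 𝔪⁴`. -/
lemma mem_sup_pow_four_of_grad_mem [CharZero k] {J : Ideal (MvPowerSeries (Fin n) k)}
    {ξ : MvPowerSeries (Fin n) k} (hξ : ξ ∈ varIdeal k n) (hξJ : ξ ∈ J)
    (hJ : J ≤ Ideal.span {ξ} ⊔ varIdeal k n ^ 2) {f : MvPowerSeries (Fin n) k}
    (hf : f ∈ varIdeal k n) (hd : grad k n f ∈ diffRel J) : f ∈ J ⊔ varIdeal k n ^ 4 := by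
  have hJm : J ≤ varIdeal k n := hJ.trans (sup_le ((Ideal.span_singleton_le_iff_mem _).2 hξ)
    (Ideal.pow_le_self two_ne_zero))
  obtain ⟨g, hg, hfg⟩ := exists_grad_of_mem_diffRel hd
  obtain ⟨u, hu, h1, h2⟩ := exists_pderiv_sub_mem_sq hξ hξJ hJ (f := f - g)
    fun i => by rw [map_sub]; exact hfg i
  have h6 : euler k n (f - g - u) ∈ J := euler_mem h1
  have h7 : f - g - u ∈ varIdeal k n := sub_mem (sub_mem hf (hJm hg)) (hJm hu)
  -- Partials in `𝔪²` give order three. The Euler derivative, which lies in `J`, is three times the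
  -- series modulo `𝔪⁴`, and this gains one more order modulo `J`.
  have h8 : f - g - u ∈ varIdeal k n ^ (2 + 1) := mem_pow_of_pderiv_mem_pow h7 h2
  have h3 : f - g - u ∈ J ⊔ varIdeal k n ^ (2 + 1 + 1) :=
    mem_sup_pow_succ_of_euler_mem (Nat.succ_ne_zero _) h8 h6
  have h4 : f ∈ J ⊔ varIdeal k n ^ (2 + 1 + 1) := by
    have := add_mem h3 (Ideal.mem_sup_left (T := varIdeal k n ^ (2 + 1 + 1)) (add_mem hg hu))
    rwa [sub_sub, sub_add_cancel] at this
  exact h4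

end PowerSeries

end Berger

namespace Berger

open MvPowerSeries

/-! ### The exterior square of `k^h` -/

section Wedge

variable {k : Type*} [Field k]

/-- The `2 × 2` minors of the matrix with rows `a` and `b`, indexed by the pairs `p < q`. -/
def wedge (k : Type*) [Field k] (h : ℕ) :
    (Fin h → k) →ₗ[k] (Fin h → k) →ₗ[k] ({p : Fin h × Fin h // p.1 < p.2} → k) :=
  LinearMap.mk₂ k (fun a b p => a p.1.1 * b p.1.2 - a p.1.2 * b p.1.1)
    (fun _ _ _ => by ext p; simp; ring) (fun _ _ _ => by ext p; simp; ring)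
    (fun _ _ _ => by ext p; simp; ring) (fun _ _ _ => by ext p; simp; ring)

lemma wedge_apply {h : ℕ} (a b : Fin h → k) (p : {p : Fin h × Fin h // p.1 < p.2}) :
    wedge k h a b p = a p.1.1 * b p.1.2 - a p.1.2 * b p.1.1 := rfl

lemma wedge_swap {h : ℕ} (a b : Fin h → k) : wedge k h a b = - wedge k h b a := by
  ext p; simp only [wedge_apply, Pi.neg_apply]; ring

lemma wedge_single {h : ℕ} (p : {p : Fin h × Fin h // p.1 < p.2}) :
    wedge k h (Pi.single p.1.1 1) (Pi.single p.1.2 1) = Pi.single p 1 := by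
  classical
  obtain ⟨⟨i, j⟩, hij⟩ := p
  ext ⟨⟨i', j'⟩, hij'⟩
  simp only [wedge_apply, Pi.single_apply, Subtype.mk.injEq, Prod.mk.injEq]
  have : ¬ (j' = i ∧ i' = j) := by
    rintro ⟨rfl, rfl⟩; exact absurd hij (not_lt.2 (le_of_lt hij'))
  by_cases h1 : i' = i <;> by_cases h2 : j' = j <;> by_cases h3 : j' = i <;>
    by_cases h4 : i' = j <;> simp_all

lemma card_pairs (h : ℕ) :
    Fintype.card {p : Fin h × Fin h // p.1 < p.2} * 2 = h * (h - 1) := by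
  classical
  rw [Fintype.card_subtype, Finset.card_filter, Fintype.sum_prod_type_right]
  have : ∀ q : Fin h, (∑ p : Fin h, if p < q then 1 else 0) = (q : ℕ) := by
    intro q
    rw [← Finset.card_filter]
    have : (Finset.univ.filter fun p => p < q) = Finset.Iio q := by ext; simp
    rw [this, Fin.card_Iio]
  simp only [this]
  rw [Fin.sum_univ_eq_sum_range (fun i => i) h, Finset.sum_range_id_mul_two]

/-- The final count loses `1` for the constants and at most `1 + h` for `𝔪_A⁴`; strict inequality
needs one more. The bound fails for `h = 4`, which is where `n ≥ 6` enters. -/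
lemma add_three_le_card_pairs {h : ℕ} (hh : 5 ≤ h) :
    h + 3 ≤ Fintype.card {p : Fin h × Fin h // p.1 < p.2} := by
  have := card_pairs h
  obtain ⟨m, rfl⟩ := Nat.exists_eq_add_of_le hh
  have e : 5 + m - 1 = 4 + m := by omega
  rw [e] at this
  nlinarith

end Wedge

/-! ### The exterior derivative at the origin -/

section Exterior

variable {k : Type*} [Field k] {n h : ℕ}

/-- The value at the origin of the exterior derivative of the form `∑ vᵢ dXᵢ`, pushed forward
along the linear map `w`. -/
noncomputable def extDerivZero (w : (Fin n → k) →ₗ[k] (Fin h → k)) :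
    (Fin n → MvPowerSeries (Fin n) k) →ₗ[k] ({p : Fin h × Fin h // p.1 < p.2} → k) :=
  ∑ i, ((wedge k h).flip (w (Pi.single i 1))) ∘ₗ w ∘ₗ gradZero k n ∘ₗ LinearMap.proj i

lemma extDerivZero_apply (w : (Fin n → k) →ₗ[k] (Fin h → k))
    (v : Fin n → MvPowerSeries (Fin n) k) :
    extDerivZero w v = ∑ i, wedge k h (w (gradZero k n (v i))) (w (Pi.single i 1)) := by
  simp [extDerivZero, LinearMap.sum_apply]

lemma eq_sum_smul_single (w : (Fin n → k) →ₗ[k] (Fin h → k)) (u : Fin n → k) :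
    w u = ∑ j, u j • w (Pi.single j 1) := by
  classical
  conv_lhs => rw [pi_eq_sum_univ' u]
  rw [map_sum]
  refine Finset.sum_congr rfl fun j _ => ?_
  rw [map_smul]

/-- This is `d ∘ d = 0`: the symmetric Hessian is paired with an alternating form, so the sum equals
its own negative. -/
lemma extDerivZero_grad [CharZero k] (w : (Fin n → k) →ₗ[k] (Fin h → k))
    (g : MvPowerSeries (Fin n) k) : extDerivZero w (grad k n g) = 0 := by
  have e : extDerivZero w (grad k n g) = ∑ i, ∑ j, constantCoeff (pderiv k j (pderiv k i g)) •
      wedge k h (w (Pi.single j 1)) (w (Pi.single i 1)) := by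
    rw [extDerivZero_apply]
    refine Finset.sum_congr rfl fun i _ => ?_
    rw [grad_apply, eq_sum_smul_single w (gradZero k n _), map_sum, LinearMap.sum_apply]
    refine Finset.sum_congr rfl fun j _ => ?_
    rw [map_smul, LinearMap.smul_apply, gradZero_apply]
  have e' : extDerivZero w (grad k n g) = - extDerivZero w (grad k n g) := by
    conv_lhs => rw [e, Finset.sum_comm]
    rw [e, ← Finset.sum_neg_distrib]
    refine Finset.sum_congr rfl fun i _ => ?_
    rw [← Finset.sum_neg_distrib]
    refine Finset.sum_congr rfl fun j _ => ?_
    rw [wedge_swap, smul_neg, pderiv_comm]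
  exact self_eq_neg.1 e'

/-- The Leibniz rule `d(p ω) = p dω + dp ∧ ω`, evaluated at the origin. -/
lemma extDerivZero_smul (w : (Fin n → k) →ₗ[k] (Fin h → k)) (p : MvPowerSeries (Fin n) k)
    (v : Fin n → MvPowerSeries (Fin n) k) :
    extDerivZero w (p • v) = constantCoeff p • extDerivZero w v +
      wedge k h (w (gradZero k n p)) (w fun i => constantCoeff (v i)) := by
  rw [eq_sum_smul_single w fun i => constantCoeff (v i), map_sum, extDerivZero_apply,
    extDerivZero_apply, Finset.smul_sum, ← Finset.sum_add_distrib]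
  refine Finset.sum_congr rfl fun i _ => ?_
  rw [Pi.smul_apply, smul_eq_mul, gradZero_mul, map_add, map_add, map_smul, map_smul, map_smul,
    map_smul, LinearMap.add_apply, LinearMap.smul_apply, LinearMap.smul_apply, map_smul]

lemma extDerivZero_surjective {w : (Fin n → k) →ₗ[k] (Fin h → k)} (hw : Function.Surjective w) :
    Function.Surjective (extDerivZero w) := by
  classical
  rw [← LinearMap.range_eq_top, eq_top_iff]
  rintro y -
  rw [pi_eq_sum_univ' y]
  refine sum_mem fun p _ => Submodule.smul_mem _ _ ?_
  obtain ⟨a, ha⟩ := hw (Pi.single p.1.1 1)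
  obtain ⟨b, hb⟩ := hw (Pi.single p.1.2 1)
  -- The form `(∑ aⱼXⱼ) · ∑ bᵢ dXᵢ` has exterior derivative `a ∧ b`.
  refine ⟨fun i => b i • ∑ j, a j • X j, ?_⟩
  have hX : gradZero k n (∑ j, a j • X j) = a := by
    rw [map_sum]
    ext i
    simp [gradZero_X, Finset.sum_apply, Pi.single_apply]
  have : extDerivZero w (fun i => b i • ∑ j, a j • X j) = wedge k h (w a) (w b) := by
    rw [extDerivZero_apply, eq_sum_smul_single w b, map_sum]
    refine Finset.sum_congr rfl fun i _ => ?_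
    rw [map_smul, hX, map_smul, map_smul, map_smul, LinearMap.smul_apply]
  rw [this, ha, hb, wedge_single]

lemma extDerivZero_eq_zero_of_mem_diffRel [CharZero k] {w : (Fin n → k) →ₗ[k] (Fin h → k)}
    {J : Ideal (MvPowerSeries (Fin n) k)} (hJ : ∀ g ∈ J, w (gradZero k n g) = 0)
    {v : Fin n → MvPowerSeries (Fin n) k} (hv : v ∈ diffRel J) : extDerivZero w v = 0 := by
  obtain ⟨a, ha, b, hb, rfl⟩ := Submodule.mem_sup.1 hv
  rw [map_add]
  have h1 : extDerivZero w b = 0 := by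
    rw [extDerivZero_apply]
    refine Finset.sum_eq_zero fun i _ => ?_
    rw [hJ _ (hb i trivial), map_zero, LinearMap.zero_apply]
  rw [h1, add_zero]
  -- The map is only `k`-linear, so the induction runs over sums of terms `p • grad g`.
  refine Submodule.closure_induction (p := fun a _ => extDerivZero w a = 0) ?_ ?_ ?_ ha
  · exact map_zero _
  · intro x y _ _ hx hy; rw [map_add, hx, hy, add_zero]
  · rintro p _ ⟨g, hg, rfl⟩
    have : (fun i => constantCoeff (grad k n g i)) = gradZero k n g := rfl
    rw [extDerivZero_smul, extDerivZero_grad, this, hJ g hg, smul_zero, map_zero, add_zero]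

end Exterior

/-! ### Lower bound for the differentials of an Artinian quotient -/

section Artinian

variable {k : Type*} [Field k] {n : ℕ}

/-- The image of `𝔪 ^ q` in `k⟦X₁, …, Xₙ⟧ ⧸ J`. -/
noncomputable def powImage (J : Ideal (MvPowerSeries (Fin n) k)) (q : ℕ) :
    Submodule k (MvPowerSeries (Fin n) k ⧸ J) :=
  ((varIdeal k n ^ q).restrictScalars k).map (Ideal.Quotient.mkₐ k J).toLinearMap

lemma mk_mem_powImage {J : Ideal (MvPowerSeries (Fin n) k)} {q : ℕ} {f : MvPowerSeries (Fin n) k}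
    (hf : f ∈ varIdeal k n ^ q) : Ideal.Quotient.mk J f ∈ powImage J q :=
  ⟨f, hf, rfl⟩

/-- The form `(a, b) ↦ σ (a * b)` embeds `A` in its dual and sends `𝔪_A⁴` into the annihilator of
`𝔪_A²`, because `𝔪_A⁶ = 0`. -/
lemma finrank_powImage_four_le {J : Ideal (MvPowerSeries (Fin n) k)}
    [Module.Finite k (MvPowerSeries (Fin n) k ⧸ J)] (h6 : varIdeal k n ^ 6 ≤ J)
    (σ : (MvPowerSeries (Fin n) k ⧸ J) →ₗ[k] k) (hσ : ∀ a, (∀ b, σ (a * b) = 0) → a = 0) :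
    Module.finrank k (powImage J 4) + Module.finrank k (powImage J 2) ≤
      Module.finrank k (MvPowerSeries (Fin n) k ⧸ J) := by
  let τ : (MvPowerSeries (Fin n) k ⧸ J) →ₗ[k] Module.Dual k (MvPowerSeries (Fin n) k ⧸ J) :=
    (LinearMap.mul k _).compr₂ σ
  have hτ : Function.Injective τ := by
    rw [← LinearMap.ker_eq_bot, LinearMap.ker_eq_bot']
    intro a ha
    exact hσ a fun b => LinearMap.congr_fun ha b
  have hle : (powImage J 4).map τ ≤ (powImage J 2).dualAnnihilator := by
    rintro _ ⟨_, ⟨f, hf, rfl⟩, rfl⟩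
    rw [Submodule.mem_dualAnnihilator]
    rintro _ ⟨g, hg, rfl⟩
    have hfg : f * g ∈ J := by
      refine h6 ?_
      rw [show 6 = 4 + 2 by rfl, pow_add]
      exact Ideal.mul_mem_mul hf hg
    change σ (Ideal.Quotient.mk J f * Ideal.Quotient.mk J g) = 0
    rw [← map_mul, Ideal.Quotient.eq_zero_iff_mem.2 hfg, map_zero]
  have h1 := Submodule.finrank_mono hle
  rw [← (Submodule.equivMapOfInjective τ hτ (powImage J 4)).finrank_eq] at h1
  have h2 := Subspace.finrank_add_finrank_dualAnnihilator_eq (powImage J 2)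
  omega

/-- The constant term and the linear part modulo that of `ξ` define a map from `A` to a space of
dimension `1 + h`, with kernel inside `𝔪_A²`. -/
lemma le_finrank_powImage_two_add [CharZero k] {h : ℕ} {J : Ideal (MvPowerSeries (Fin n) k)}
    [Module.Finite k (MvPowerSeries (Fin n) k ⧸ J)]
    {ξ : MvPowerSeries (Fin n) k} (hξ : ξ ∈ varIdeal k n) (hξJ : ξ ∈ J)
    (hJm : J ≤ varIdeal k n) {w : (Fin n → k) →ₗ[k] (Fin h → k)}
    (hker : LinearMap.ker w ≤ Submodule.span k {gradZero k n ξ})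
    (hwJ : ∀ g ∈ J, w (gradZero k n g) = 0) :
    Module.finrank k (MvPowerSeries (Fin n) k ⧸ J) ≤ Module.finrank k (powImage J 2) + (1 + h) := by
  let c : MvPowerSeries (Fin n) k →ₗ[k] k :=
    { toFun := constantCoeff, map_add' := by simp, map_smul' := by simp }
  let θ' : MvPowerSeries (Fin n) k →ₗ[k] k × (Fin h → k) := c.prod (w ∘ₗ gradZero k n)
  have hθ' : J.restrictScalars k ≤ LinearMap.ker θ' := by
    intro g hg
    rw [LinearMap.mem_ker]
    exact Prod.ext (mem_varIdeal_iff.1 (hJm hg)) (hwJ g hg)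
  let θ : (MvPowerSeries (Fin n) k ⧸ J) →ₗ[k] k × (Fin h → k) :=
    (J.restrictScalars k).liftQ θ' hθ'
  have hθ : LinearMap.ker θ ≤ powImage J 2 := by
    intro a ha
    obtain ⟨f, rfl⟩ := Ideal.Quotient.mk_surjective a
    have hf : θ' f = 0 := ha
    have hf0 : constantCoeff f = 0 := congrArg Prod.fst hf
    have hf1 : w (gradZero k n f) = 0 := congrArg Prod.snd hf
    obtain ⟨b, hb⟩ := Submodule.mem_span_singleton.1 (hker (LinearMap.mem_ker.2 hf1))
    have hsq : f - b • ξ ∈ varIdeal k n ^ 2 := by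
      refine mem_sq_of_gradZero_eq_zero (sub_mem (mem_varIdeal_iff.2 hf0) ?_) ?_
      · rw [smul_eq_C_mul]; exact Ideal.mul_mem_left _ _ hξ
      · rw [map_sub, map_smul, hb, sub_self]
    have : Ideal.Quotient.mk J f = Ideal.Quotient.mk J (f - b • ξ) := by
      rw [Ideal.Quotient.eq, sub_sub_cancel, smul_eq_C_mul]
      exact Ideal.mul_mem_left _ _ hξJ
    rw [this]
    exact mk_mem_powImage hsq
  have h1 := LinearMap.finrank_range_add_finrank_ker θ
  have h2 := Submodule.finrank_mono hθ
  have h3 := Submodule.finrank_le (LinearMap.range θ)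
  rw [Module.finrank_prod, Module.finrank_self, Module.finrank_fin_fun] at h3
  omega

/-- The quotient by the line through `ℓ`. As `ℓ` may vanish, `h` is `n - 1` or `n`. -/
lemma exists_surjective_ker_eq_span (ℓ : Fin n → k) :
    ∃ (h : ℕ) (w : (Fin n → k) →ₗ[k] (Fin h → k)), n ≤ h + 1 ∧ Function.Surjective w ∧
      LinearMap.ker w = Submodule.span k {ℓ} := by
  let q := (Submodule.span k {ℓ}).mkQ
  let e := Module.finBasis k ((Fin n → k) ⧸ Submodule.span k {ℓ})
  refine ⟨_, e.equivFun.toLinearMap ∘ₗ q, ?_, ?_, ?_⟩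
  · have h1 := Submodule.finrank_quotient_add_finrank (Submodule.span k {ℓ})
    have h2 := finrank_span_le_card (R := k) ({ℓ} : Set (Fin n → k))
    rw [Module.finrank_fin_fun] at h1
    simp only [Set.toFinset_singleton, Finset.card_singleton] at h2
    omega
  · exact e.equivFun.surjective.comp (Submodule.mkQ_surjective _)
  · rw [LinearEquiv.ker_comp, Submodule.ker_mkQ]

/-- Let `A = k⟦X₁, …, Xₙ⟧ ⧸ J` be Artinian with `𝔪_A ^ 6 = 0`, of embedding dimension at least
`n - 1 ≥ 5` and with a nondegenerate trace form `σ`. Then the length of the module of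
differentials of `A` exceeds the length of `A`. -/
theorem finrank_quotient_lt_finrank_differentials [CharZero k]
    {J : Ideal (MvPowerSeries (Fin n) k)} [Module.Finite k (MvPowerSeries (Fin n) k ⧸ J)]
    [Module.Finite k ((Fin n → MvPowerSeries (Fin n) k) ⧸ diffRel J)] (hn : 6 ≤ n)
    {ξ : MvPowerSeries (Fin n) k} (hξ : ξ ∈ varIdeal k n) (hξJ : ξ ∈ J)
    (hJ : J ≤ Ideal.span {ξ} ⊔ varIdeal k n ^ 2) (h6 : varIdeal k n ^ 6 ≤ J)
    (σ : (MvPowerSeries (Fin n) k ⧸ J) →ₗ[k] k) (hσ : ∀ a, (∀ b, σ (a * b) = 0) → a = 0) :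
    Module.finrank k (MvPowerSeries (Fin n) k ⧸ J) <
      Module.finrank k ((Fin n → MvPowerSeries (Fin n) k) ⧸ diffRel J) := by
  have hJm : J ≤ varIdeal k n := hJ.trans (sup_le ((Ideal.span_singleton_le_iff_mem _).2 hξ)
    (Ideal.pow_le_self two_ne_zero))
  obtain ⟨h, w, hh, hw, hker⟩ := exists_surjective_ker_eq_span (gradZero k n ξ)
  have hwJ : ∀ g ∈ J, w (gradZero k n g) = 0 := by
    intro g hg
    obtain ⟨c, hc⟩ := exists_sub_smul_mem_sq hξ hJ hg
    have h1 := gradZero_eq_zero_of_mem_sq hc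
    rw [map_sub, map_smul, sub_eq_zero] at h1
    rw [← LinearMap.mem_ker, hker, h1]
    exact Submodule.smul_mem _ _ (Submodule.mem_span_singleton_self _)
  -- `β` is the exterior derivative at the origin and `D` the universal derivation of `A`; they
  -- compose to zero.
  let β : ((Fin n → MvPowerSeries (Fin n) k) ⧸ diffRel J) →ₗ[k] _ :=
    ((diffRel J).restrictScalars k).liftQ (extDerivZero w)
      fun v hv => extDerivZero_eq_zero_of_mem_diffRel hwJ hv
  have hβ : Function.Surjective β := by
    intro y
    obtain ⟨v, rfl⟩ := extDerivZero_surjective hw y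
    exact ⟨Submodule.Quotient.mk v, rfl⟩
  let D : (MvPowerSeries (Fin n) k ⧸ J) →ₗ[k] ((Fin n → MvPowerSeries (Fin n) k) ⧸ diffRel J) :=
    (J.restrictScalars k).liftQ (((diffRel J).mkQ.restrictScalars k) ∘ₗ grad k n) fun g hg => by
      rw [LinearMap.mem_ker]
      exact (Submodule.Quotient.mk_eq_zero _).2
        (Submodule.mem_sup_left (Submodule.subset_span ⟨g, hg, rfl⟩))
  have hDβ : LinearMap.range D ≤ LinearMap.ker β := by
    rintro _ ⟨a, rfl⟩
    obtain ⟨f, rfl⟩ := Ideal.Quotient.mk_surjective a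
    exact extDerivZero_grad w f
  have hDker : LinearMap.ker D ≤ Submodule.span k {1} ⊔ powImage J 4 := by
    intro a ha
    obtain ⟨f, rfl⟩ := Ideal.Quotient.mk_surjective a
    have hf : grad k n f ∈ diffRel J := (Submodule.Quotient.mk_eq_zero _).1 ha
    have hf' : grad k n (f - C (constantCoeff f)) ∈ diffRel J := by
      convert hf using 1
      ext1 i; simp
    obtain ⟨u, hu, v, hv, huv⟩ := Submodule.mem_sup.1
      (mem_sup_pow_four_of_grad_mem hξ hξJ hJ (sub_C_mem_varIdeal f) hf')
    have : Ideal.Quotient.mk J f = constantCoeff f • 1 + Ideal.Quotient.mk J v := by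
      have e : f = C (constantCoeff f) + v + u := by rw [add_assoc, add_comm v, huv]; ring
      conv_lhs => rw [e]
      have e' : Ideal.Quotient.mk J (C (constantCoeff f)) =
          constantCoeff f • (1 : MvPowerSeries (Fin n) k ⧸ J) := by
        change _ = Ideal.Quotient.mk J (constantCoeff f • 1)
        rw [smul_eq_C_mul, mul_one]
      rw [map_add, map_add, Ideal.Quotient.eq_zero_iff_mem.2 hu, add_zero, e']
    rw [this]
    exact Submodule.add_mem_sup (Submodule.smul_mem _ _ (Submodule.mem_span_singleton_self _))
      (mk_mem_powImage hv)
  -- The count: `dim A - 1 - dim 𝔪_A⁴ ≤ rank D ≤ dim ker β = dim Ω_A - h(h-1)/2`, with `dim 𝔪_A⁴ ≤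
  -- dim A - dim 𝔪_A² ≤ 1 + h`.
  have e1 := LinearMap.finrank_range_add_finrank_ker D
  have e2 := Submodule.finrank_mono hDker
  have e3 := Submodule.finrank_add_le_finrank_add_finrank
    (Submodule.span k {(1 : MvPowerSeries (Fin n) k ⧸ J)}) (powImage J 4)
  have e4 := finrank_span_le_card (R := k) ({1} : Set (MvPowerSeries (Fin n) k ⧸ J))
  simp only [Set.toFinset_singleton, Finset.card_singleton] at e4
  have e5 := finrank_powImage_four_le h6 σ hσ
  have e6 := le_finrank_powImage_two_add hξ hξJ hJm hker.le hwJ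
  have e7 := LinearMap.finrank_range_add_finrank_ker β
  rw [LinearMap.range_eq_top.2 hβ, finrank_top, Module.finrank_fintype_fun_eq_card] at e7
  have e8 := Submodule.finrank_mono hDβ
  have e9 := add_three_le_card_pairs (h := h) (by omega)
  omega

end Artinian

end Berger

namespace Berger

open CategoryTheory CategoryTheory.Abelian

universe v

/-! ### Finite injective dimension and the socle of `R ⧸ xR` -/

section Gorenstein

variable {R : Type v} [CommRing R]

/-- The short exact sequence `0 → N → M → M ⧸ range f → 0` of an injective linear map `f`. -/
abbrev cokerComplex {N M : Type v} [AddCommGroup N] [Module R N] [AddCommGroup M] [Module R M]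
    (f : N →ₗ[R] M) : ShortComplex (ModuleCat.{v} R) :=
  ModuleCat.shortComplexOfCompEqZero f (LinearMap.range f).mkQ
    f.exact_map_mkQ_range.linearMap_comp_eq_zero

lemma cokerComplex_shortExact {N M : Type v} [AddCommGroup N] [Module R N] [AddCommGroup M]
    [Module R M] {f : N →ₗ[R] M} (hf : Function.Injective f) : (cokerComplex f).ShortExact :=
  ModuleCat.shortComplex_shortExact _ f.exact_map_mkQ_range hf (Submodule.mkQ_surjective _)

/-- Multiplication by `x` on `R`. -/
abbrev mulMap (x : R) : R →ₗ[R] R := LinearMap.mulLeft R x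

lemma mulMap_injective [IsDomain R] {x : R} (hx : x ≠ 0) : Function.Injective (mulMap x) :=
  fun _ _ h => mul_left_cancel₀ hx h

lemma range_mulMap (x : R) : LinearMap.range (mulMap x) = Ideal.span {x} := by
  ext y
  rw [Ideal.mem_span_singleton']
  constructor
  · rintro ⟨a, rfl⟩; exact ⟨a, by simp [mul_comm]⟩
  · rintro ⟨a, rfl⟩; exact ⟨a, by simp [mul_comm]⟩

/-- Multiplication by `x` gives a free resolution of `R ⧸ xR` of length one. -/
lemma ext_quotient_eq_zero [IsDomain R] {x : R} (hx : x ≠ 0) (Y : ModuleCat.{v} R) (i : ℕ)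
    (e : Ext (ModuleCat.of R (R ⧸ LinearMap.range (mulMap x))) Y (i + 2)) : e = 0 := by
  have hS := cokerComplex_shortExact (mulMap_injective hx)
  have : Projective (ModuleCat.of R R) := inferInstance
  obtain ⟨e', rfl⟩ := Ext.contravariant_sequence_exact₃ hS Y e
    (Ext.eq_zero_of_projective (P := ModuleCat.of R R) _) (n₀ := i + 1) (by omega)
  have : e' = 0 := Ext.eq_zero_of_projective (P := ModuleCat.of R R) e'
  rw [this, Ext.comp_zero]

lemma ext_eq_zero_of_subsingleton {N : Type v} [AddCommGroup N] [Module R N] [Subsingleton N]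
    {Y : ModuleCat.{v} R} {i : ℕ} (e : Ext (ModuleCat.of R N) Y i) : e = 0 := by
  have h : 𝟙 (ModuleCat.of R N) = 0 := by
    ext a; exact Subsingleton.elim _ _
  rw [← Ext.mk₀_id_comp e, h, Ext.mk₀_zero, Ext.zero_comp]

/-- A nonzero Artinian module contains a simple one, and over a local ring all simple modules are
isomorphic. -/
lemma exists_injective_of_isSimpleModule [IsLocalRing R] {A : Type v} [AddCommGroup A] [Module R A]
    [IsArtinian R A] [Nontrivial A] (N : Type v) [AddCommGroup N] [Module R N]
    [IsSimpleModule R N] : ∃ f : N →ₗ[R] A, Function.Injective f := by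
  obtain ⟨S, hS⟩ := IsAtomic.exists_atom (Submodule R A)
  have : IsSimpleModule R S := isSimpleModule_iff_isAtom.2 hS
  obtain ⟨I, hI, ⟨e⟩⟩ := isSimpleModule_iff_quot_maximal.1 ‹IsSimpleModule R N›
  obtain ⟨I', hI', ⟨e'⟩⟩ := isSimpleModule_iff_quot_maximal.1 this
  have h : I = I' := (IsLocalRing.eq_maximalIdeal hI).trans (IsLocalRing.eq_maximalIdeal hI').symm
  subst h
  exact ⟨S.subtype ∘ₗ (e.trans e'.symm).toLinearMap,
    S.injective_subtype.comp (e.trans e'.symm).injective⟩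

/-- Over a local domain with finite injective dimension, `Ext i N R` vanishes for `i ≥ 2` and `N` of
finite length, if some `R ⧸ x R` is nonzero of finite length. -/
lemma ext_eq_zero_of_isFiniteLength [IsLocalRing R] [IsNoetherianRing R] [IsDomain R]
    (hGor : IsGorensteinLocal R) {x : R} (hx : x ≠ 0)
    [IsArtinian R (R ⧸ LinearMap.range (mulMap x))]
    [Nontrivial (R ⧸ LinearMap.range (mulMap x))] (i : ℕ) (N : Type v) [AddCommGroup N]
    [Module R N] (hN : IsFiniteLength R N)
    (e : Ext (ModuleCat.of R N) (ModuleCat.of R R) (i + 2)) : e = 0 := by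
  obtain ⟨d, hd⟩ := (injectiveDimension_ne_top_iff _).1 hGor.ne
  have hlarge : ∀ (N : Type v) [AddCommGroup N] [Module R N] (i : ℕ), d + 1 ≤ i →
      ∀ e : Ext (ModuleCat.of R N) (ModuleCat.of R R) i, e = 0 :=
    fun N _ _ i hi e => e.eq_zero_of_hasInjectiveDimensionLT (d + 1) hi
  -- Descending induction on the degree, starting above the injective dimension. For simple `N ⊆ R ⧸
  -- xR`, the group `Ext^(i+2)(N, R)` sits between `Ext^(i+2)(R ⧸ xR, R) = 0` and `Ext^(i+3)` of the
  -- cokernel.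
  suffices H : ∀ j i : ℕ, d ≤ i + j → ∀ (N : Type v) [AddCommGroup N] [Module R N],
      IsFiniteLength R N → ∀ e : Ext (ModuleCat.of R N) (ModuleCat.of R R) (i + 2), e = 0 from
    H d i (by omega) N hN e
  intro j
  induction j with
  | zero => intro i hi N _ _ _ e; exact hlarge N _ (by omega) e
  | succ j ih =>
    intro i hi N _ _ hN
    have hsimple : ∀ (N : Type v) [AddCommGroup N] [Module R N] [IsSimpleModule R N]
        (e : Ext (ModuleCat.of R N) (ModuleCat.of R R) (i + 2)), e = 0 := by
      intro N _ _ _ e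
      obtain ⟨f, hf⟩ := exists_injective_of_isSimpleModule (R := R)
        (A := R ⧸ LinearMap.range (mulMap x)) N
      have hS := cokerComplex_shortExact hf
      have hfin : IsFiniteLength R ((R ⧸ LinearMap.range (mulMap x)) ⧸ LinearMap.range f) :=
        isFiniteLength_iff_isNoetherian_isArtinian.2 ⟨inferInstance, inferInstance⟩
      obtain ⟨e', rfl⟩ := Ext.contravariant_sequence_exact₁ hS (ModuleCat.of R R) e
        (n₁ := i + 1 + 2) (by omega) (ih (i + 1) (by omega) _ hfin _)
      rw [ext_quotient_eq_zero hx _ i e', Ext.comp_zero]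
    induction hN with
    | of_subsingleton => intro e; exact ext_eq_zero_of_subsingleton e
    | @of_simple_quotient M _ _ L hL _ ihL =>
      intro e
      have hS : (cokerComplex L.subtype).ShortExact :=
        cokerComplex_shortExact L.injective_subtype
      obtain ⟨e', rfl⟩ := Ext.contravariant_sequence_exact₂ hS (ModuleCat.of R R) e (ihL _)
      have : IsSimpleModule R (M ⧸ LinearMap.range L.subtype) := by
        rw [Submodule.range_subtype]; exact hL
      rw [hsimple _ e', Ext.comp_zero]

/-- The map `R ⧸ 𝔪 → A` sending `1` to an element `s` of the socle of `A`. -/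
noncomputable def socleMap [IsLocalRing R] {A : Type v} [AddCommGroup A] [Module R A] (s : A)
    (hs : ∀ r ∈ IsLocalRing.maximalIdeal R, r • s = 0) :
    (R ⧸ IsLocalRing.maximalIdeal R) →ₗ[R] A :=
  (IsLocalRing.maximalIdeal R).liftQ (LinearMap.toSpanSingleton R A s) fun r hr => by
    rw [LinearMap.mem_ker, LinearMap.toSpanSingleton_apply, hs r hr]

lemma socleMap_one [IsLocalRing R] {A : Type v} [AddCommGroup A] [Module R A] (s : A)
    (hs : ∀ r ∈ IsLocalRing.maximalIdeal R, r • s = 0) :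
    socleMap s hs (Submodule.Quotient.mk 1) = s := by
  change (1 : R) • s = s
  rw [one_smul]

lemma exists_eq_smul_of_linearMap (I : Ideal R) (L : (R ⧸ I) →ₗ[R] (R ⧸ I)) :
    ∃ b : R, ∀ s, L s = b • s := by
  obtain ⟨b, hb⟩ := Submodule.Quotient.mk_surjective _ (L (Submodule.Quotient.mk 1))
  refine ⟨b, fun s => ?_⟩
  obtain ⟨r, rfl⟩ := Submodule.Quotient.mk_surjective _ s
  have h1 : (Submodule.Quotient.mk r : R ⧸ I) = r • Submodule.Quotient.mk 1 := by
    rw [← Submodule.Quotient.mk_smul, smul_eq_mul, mul_one]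
  rw [h1, map_smul, ← hb, ← Submodule.Quotient.mk_smul, ← Submodule.Quotient.mk_smul,
    ← Submodule.Quotient.mk_smul]
  simp [mul_comm]

/-- The socle of `R ⧸ x R` is generated by each of its nonzero elements, if `R` is Gorenstein. -/
lemma exists_smul_eq_of_mem_socle [IsLocalRing R] [IsNoetherianRing R] [IsDomain R]
    (hGor : IsGorensteinLocal R) {x : R} (hx : x ≠ 0)
    [IsArtinian R (R ⧸ LinearMap.range (mulMap x))]
    [Nontrivial (R ⧸ LinearMap.range (mulMap x))]
    (s t : R ⧸ LinearMap.range (mulMap x)) (hs0 : s ≠ 0)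
    (hs : ∀ r ∈ IsLocalRing.maximalIdeal R, r • s = 0)
    (ht : ∀ r ∈ IsLocalRing.maximalIdeal R, r • t = 0) : ∃ r : R, t = r • s := by
  have : IsSimpleModule R (R ⧸ IsLocalRing.maximalIdeal R) :=
    isSimpleModule_iff_quot_maximal.2
      ⟨_, IsLocalRing.maximalIdeal.isMaximal R, ⟨LinearEquiv.refl _ _⟩⟩
  have hinj : Function.Injective (socleMap s hs) := by
    refine LinearMap.injective_of_ne_zero fun h => hs0 ?_
    rw [← socleMap_one s hs, h, LinearMap.zero_apply]
  have hx_mem : x ∈ IsLocalRing.maximalIdeal R := by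
    by_contra hxm
    have hu : IsUnit x := by simpa using hxm
    obtain ⟨⟨a⟩, ⟨b⟩, hab⟩ := exists_pair_ne (R ⧸ LinearMap.range (mulMap x))
    refine hab ((Submodule.Quotient.eq _).2 ?_)
    rw [range_mulMap, Ideal.span_singleton_eq_top.2 hu]
    trivial
  have hS := cokerComplex_shortExact hinj
  have hT := cokerComplex_shortExact (mulMap_injective hx)
  let φ : ModuleCat.of R (R ⧸ IsLocalRing.maximalIdeal R) ⟶
    ModuleCat.of R (R ⧸ LinearMap.range (mulMap x)) := ModuleCat.ofHom (socleMap t ht)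
  -- Pull the extension `0 → R → R → R ⧸ xR → 0` back along `t`. The vanishing of `Ext²` extends
  -- this class along `s` to a class `η` on `R ⧸ xR`.
  let e : Ext (ModuleCat.of R (R ⧸ IsLocalRing.maximalIdeal R)) (ModuleCat.of R R) 1 :=
    (Ext.mk₀ φ).comp hT.extClass (zero_add 1)
  have hfin : IsFiniteLength R ((R ⧸ LinearMap.range (mulMap x)) ⧸
      LinearMap.range (socleMap s hs)) :=
    isFiniteLength_iff_isNoetherian_isArtinian.2 ⟨inferInstance, inferInstance⟩
  obtain ⟨η, hη⟩ := Ext.contravariant_sequence_exact₁ hS (ModuleCat.of R R) e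
    (n₁ := 0 + 2) (by omega) (ext_eq_zero_of_isFiniteLength hGor hx 0 _ hfin _)
  have hxη : η.comp (Ext.mk₀ (cokerComplex (mulMap x)).f) (add_zero 1) = 0 := by
    have h1 : (cokerComplex (mulMap x)).f = x • 𝟙 (ModuleCat.of R R) := by
      ext; simp
    have h2 : x • 𝟙 (ModuleCat.of R (R ⧸ LinearMap.range (mulMap x))) = 0 := by
      refine ModuleCat.hom_ext (LinearMap.ext fun a => ?_)
      obtain ⟨a, rfl⟩ := Submodule.Quotient.mk_surjective _ a
      change x • (Submodule.Quotient.mk a : R ⧸ LinearMap.range (mulMap x)) = 0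
      rw [← Submodule.Quotient.mk_smul, Submodule.Quotient.mk_eq_zero]
      exact ⟨a, rfl⟩
    rw [h1]
    erw [← Ext.smul_eq_comp_mk₀ (R := R) η x]
    rw [← Ext.mk₀_id_comp η, ← Ext.smul_comp, ← Ext.mk₀_smul]
    erw [h2]
    rw [Ext.mk₀_zero, Ext.zero_comp]
  -- As `x η = 0`, the class `η` comes from an endomorphism `a` of `R ⧸ xR`. Then `a ∘ s` and `t`
  -- differ by a map that factors through `Hom(R ⧸ 𝔪_R, R) = 0`, and `a` is multiplication by some
  -- `b`.
  obtain ⟨α, hα⟩ := Ext.covariant_sequence_exact₁ _ hT η hxη (zero_add 1)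
  obtain ⟨a, rfl⟩ := (Ext.mk₀_bijective _ _).2 α
  have hzero : (Ext.mk₀ ((cokerComplex (socleMap s hs)).f ≫ a) - Ext.mk₀ φ).comp hT.extClass
      (zero_add 1) = 0 := by
    rw [sub_eq_add_neg, Ext.add_comp, Ext.neg_comp, ← sub_eq_add_neg, ← Ext.mk₀_comp_mk₀, Ext.comp_assoc _ _ _ _ _ (by omega), hα, hη,
      sub_self]
    omega
  obtain ⟨γ, hγ⟩ := Ext.covariant_sequence_exact₃ _ hT _ (zero_add 1) hzero
  obtain ⟨c, rfl⟩ := (Ext.mk₀_bijective _ _).2 γ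
  have hc : c = 0 := by
    ext
    have h1 : x • c.hom (Submodule.Quotient.mk 1) = 0 := by
      rw [← map_smul, ← Submodule.Quotient.mk_smul]
      have : (Submodule.Quotient.mk (x • 1) : R ⧸ IsLocalRing.maximalIdeal R) = 0 := by
        rw [Submodule.Quotient.mk_eq_zero]; simpa using hx_mem
      rw [this, map_zero]
    exact (smul_eq_zero.1 h1).resolve_left hx
  rw [hc, Ext.mk₀_zero, Ext.zero_comp] at hγ
  have hφ := (Ext.mk₀_bijective _ _).1 (sub_eq_zero.1 hγ.symm)
  obtain ⟨b, hb⟩ := exists_eq_smul_of_linearMap (LinearMap.range (mulMap x)) a.hom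
  refine ⟨b, ?_⟩
  have h1 : a.hom (socleMap s hs (Submodule.Quotient.mk 1)) =
      socleMap t ht (Submodule.Quotient.mk 1) :=
    congrArg (fun f => f.hom (Submodule.Quotient.mk 1)) hφ
  rw [socleMap_one, socleMap_one] at h1
  exact h1.symm.trans (hb s)

end Gorenstein

end Berger

namespace Berger

open MvPowerSeries

/-! ### Evaluation of power series in a complete ring -/

section Presentation

variable {k : Type*} [Field k] {R : Type*} [CommRing R] [Algebra k R] {n : ℕ}

lemma idealOfVars_pow_le_comap {I : Ideal R} {y : Fin n → R} (hy : ∀ i, y i ∈ I) (j : ℕ) :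
    MvPolynomial.idealOfVars (Fin n) k ^ j ≤
      (I ^ j).comap (MvPolynomial.aeval (R := k) y) := by
  rw [← Ideal.map_le_iff_le_comap, Ideal.map_pow]
  refine Ideal.pow_right_mono ?_ j
  rw [MvPolynomial.idealOfVars, Ideal.map_span, Ideal.span_le]
  rintro _ ⟨_, ⟨i, rfl⟩, rfl⟩
  simpa using hy i

lemma mk_aeval_truncTotal_coe {I : Ideal R} {y : Fin n → R} (hy : ∀ i, y i ∈ I) (j : ℕ)
    (q : MvPolynomial (Fin n) k) :
    Ideal.Quotient.mk (I ^ j) (MvPolynomial.aeval y (truncTotal j (q : MvPowerSeries (Fin n) k))) =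
      Ideal.Quotient.mk (I ^ j) (MvPolynomial.aeval y q) := by
  rw [Ideal.Quotient.eq, ← map_sub]
  refine idealOfVars_pow_le_comap hy j ?_
  rw [MvPolynomial.mem_pow_idealOfVars_iff']
  intro x h
  rw [MvPolynomial.coeff_sub, sub_eq_zero, coeff_truncTotal _ h, MvPolynomial.coeff_coe]

/-- Evaluation of a power series at `y`, modulo `I ^ j`. -/
noncomputable def evalMod {I : Ideal R} {y : Fin n → R} (hy : ∀ i, y i ∈ I) (j : ℕ) :
    MvPowerSeries (Fin n) k →ₐ[k] R ⧸ I ^ j where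
  toFun p := Ideal.Quotient.mk (I ^ j) (MvPolynomial.aeval y (truncTotal j p))
  map_one' := by
    rw [← MvPolynomial.coe_one, mk_aeval_truncTotal_coe hy, map_one, map_one]
  map_mul' p q := by
    rw [← map_mul, ← map_mul, Ideal.Quotient.eq, ← map_sub]
    exact idealOfVars_pow_le_comap hy j
      (truncTotal_mul_sub_mul_truncTotal_mem_pow_idealOfVars p q)
  map_zero' := by simp
  map_add' p q := by simp
  commutes' c := by
    have : algebraMap k (MvPowerSeries (Fin n) k) c =
        ((MvPolynomial.C c : MvPolynomial (Fin n) k) : MvPowerSeries (Fin n) k) := by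
      rw [MvPolynomial.coe_C]; rfl
    rw [this, mk_aeval_truncTotal_coe hy, MvPolynomial.aeval_C]
    rfl

lemma evalMod_apply {I : Ideal R} {y : Fin n → R} (hy : ∀ i, y i ∈ I) (j : ℕ)
    (p : MvPowerSeries (Fin n) k) :
    evalMod hy j p = Ideal.Quotient.mk (I ^ j) (MvPolynomial.aeval y (truncTotal j p)) := rfl

lemma factor_comp_evalMod {I : Ideal R} {y : Fin n → R} (hy : ∀ i, y i ∈ I) {i j : ℕ}
    (hij : i ≤ j) : (Ideal.Quotient.factorₐ k (Ideal.pow_le_pow_right hij)).comp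
      (evalMod (k := k) hy j) = evalMod hy i := by
  ext p
  simp only [AlgHom.comp_apply, evalMod_apply]
  change Ideal.Quotient.mk (I ^ i) _ = _
  rw [Ideal.Quotient.eq, ← map_sub]
  exact idealOfVars_pow_le_comap hy i
    (truncTotal_sub_truncTotal_mem_pow_idealOfVars hij le_rfl p)

/-- Evaluation of power series at elements `y` of an ideal `I`, in an `I`-adically complete ring. -/
noncomputable def evalAt {I : Ideal R} [IsAdicComplete I R] {y : Fin n → R} (hy : ∀ i, y i ∈ I) :
    MvPowerSeries (Fin n) k →ₐ[k] R :=
  IsAdicComplete.liftAlgHom I (fun j => evalMod hy j) (factor_comp_evalMod hy)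

lemma mk_evalAt {I : Ideal R} [IsAdicComplete I R] {y : Fin n → R} (hy : ∀ i, y i ∈ I) (j : ℕ)
    (p : MvPowerSeries (Fin n) k) : Ideal.Quotient.mk (I ^ j) (evalAt hy p) =
      Ideal.Quotient.mk (I ^ j) (MvPolynomial.aeval y (truncTotal j p)) :=
  IsAdicComplete.mk_liftAlgHom I _ (factor_comp_evalMod hy) j p

/-- The map from polynomials to `R` is onto modulo the ideal of the variables, since `R = k + I`.
The induced map of adic completions is therefore onto, and power series are the completion of
polynomials. -/
lemma evalAt_surjective {I : Ideal R} [IsAdicComplete I R] {y : Fin n → R} (hy : ∀ i, y i ∈ I)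
    (hI : I = Ideal.span (Set.range y)) (hk : ∀ r : R, ∃ c : k, r - algebraMap k R c ∈ I) :
    Function.Surjective (evalAt (k := k) hy) := by
  intro r
  let J := MvPolynomial.idealOfVars (Fin n) k
  let f : MvPolynomial (Fin n) k →+* R := (MvPolynomial.aeval y : _ →ₐ[k] R)
  let _ : Algebra (MvPolynomial (Fin n) k) R := f.toAlgebra
  have hJ : ∀ j : ℕ, ∀ r : R, r ∈ (J ^ j • ⊤ : Submodule (MvPolynomial (Fin n) k) R) ↔
      r ∈ I ^ j := by
    intro j r
    have : Ideal.map (algebraMap (MvPolynomial (Fin n) k) R) J = I := by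
      change Ideal.map f (MvPolynomial.idealOfVars (Fin n) k) = I
      rw [MvPolynomial.idealOfVars, Ideal.map_span, hI, ← Set.range_comp]
      congr 2
      ext i; simp [f]
    rw [Ideal.smul_top_eq_map, Ideal.map_pow, this]
    rfl
  have hsurj : Function.Surjective ((J • ⊤ : Submodule (MvPolynomial (Fin n) k) R).mkQ ∘ₗ
      Algebra.linearMap (MvPolynomial (Fin n) k) R) := by
    intro a
    obtain ⟨a, rfl⟩ := Submodule.mkQ_surjective _ a
    obtain ⟨c, hc⟩ := hk a
    refine ⟨MvPolynomial.C c, ?_⟩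
    rw [LinearMap.comp_apply, eq_comm, ← sub_eq_zero, ← map_sub, Submodule.mkQ_apply,
      Submodule.Quotient.mk_eq_zero, ← pow_one J, hJ, pow_one]
    convert hc using 2
    change f (MvPolynomial.C c) = _
    simp [f]
  obtain ⟨z, hz⟩ := AdicCompletion.map_surjective_of_mkQ_comp_surjective hsurj
    (AdicCompletion.of J R r)
  obtain ⟨p, rfl⟩ := (toAdicCompletionAlgEquiv (Fin n) k).surjective z
  refine ⟨p, ?_⟩
  have hH : IsHausdorff I R := inferInstance
  rw [← sub_eq_zero]
  refine hH.haus _ fun j => ?_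
  rw [SModEq.zero, smul_eq_mul, Ideal.mul_top, ← Ideal.Quotient.eq, mk_evalAt, Ideal.Quotient.eq,
    ← hJ, ← Submodule.Quotient.eq]
  have := congrArg (AdicCompletion.eval J R j) hz
  exact this

end Presentation

end Berger

namespace Berger

/-! ### Finite-dimensional quotients -/

section FiniteQuotient

variable {k : Type*} [Field k] {R : Type*} [CommRing R] [Algebra k R]

/-- If `R = k + I` and `R` is Noetherian, then `R` is the sum of `I ^ j` and a finite-dimensional
subspace. -/
lemma exists_fg_sup_pow_eq_top [IsNoetherianRing R] {I : Ideal R}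
    (hk : ∀ r : R, ∃ c : k, r - algebraMap k R c ∈ I) (j : ℕ) :
    ∃ V : Submodule k R, V.FG ∧ V ⊔ (I ^ j).restrictScalars k = ⊤ := by
  induction j with
  | zero => exact ⟨⊥, Submodule.fg_bot, by simp⟩
  | succ j ih =>
    obtain ⟨V, hV, hVj⟩ := ih
    obtain ⟨s, hs⟩ := (isNoetherianRing_iff_ideal_fg R).1 inferInstance (I ^ j)
    refine ⟨V ⊔ Submodule.span k (s : Set R), hV.sup (Submodule.fg_span s.finite_toSet), ?_⟩
    have key : (I ^ j).restrictScalars k ≤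
        Submodule.span k (s : Set R) ⊔ (I ^ (j + 1)).restrictScalars k := by
      intro r hr
      have hr' : r ∈ Submodule.span R (s : Set R) := by
        change r ∈ I ^ j at hr
        rw [← hs] at hr; exact hr
      refine Submodule.closure_induction (p := fun r _ => r ∈ Submodule.span k (s : Set R) ⊔
        (I ^ (j + 1)).restrictScalars k) (zero_mem _) (fun _ _ _ _ => add_mem) ?_ hr'
      intro a g hg
      obtain ⟨c, hc⟩ := hk a
      have : a • g = c • g + (a - algebraMap k R c) * g := by
        rw [Algebra.smul_def c g, smul_eq_mul]; ring
      rw [this]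
      refine Submodule.add_mem_sup (Submodule.smul_mem _ _ (Submodule.subset_span hg)) ?_
      change _ ∈ I ^ (j + 1)
      rw [pow_succ']
      exact Ideal.mul_mem_mul hc (hs ▸ Ideal.subset_span hg)
    rw [eq_top_iff, ← hVj, sup_assoc]
    exact sup_le_sup_left key V

lemma finite_quotient_of_pow_le [IsNoetherianRing R] {I K : Ideal R}
    (hk : ∀ r : R, ∃ c : k, r - algebraMap k R c ∈ I) {j : ℕ} (hj : I ^ j ≤ K) :
    Module.Finite k (R ⧸ K) := by
  obtain ⟨V, hV, hVj⟩ := exists_fg_sup_pow_eq_top hk j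
  refine ⟨?_⟩
  have : (⊤ : Submodule k (R ⧸ K)) = V.map (Ideal.Quotient.mkₐ k K).toLinearMap := by
    rw [eq_comm, eq_top_iff]
    rintro a -
    obtain ⟨r, rfl⟩ := Ideal.Quotient.mk_surjective a
    obtain ⟨v, hv, w, hw, rfl⟩ := Submodule.mem_sup.1 (hVj.ge (Submodule.mem_top (x := r)))
    refine ⟨v, hv, ?_⟩
    rw [map_add, Ideal.Quotient.eq_zero_iff_mem.2 (hj hw), add_zero]
    rfl
  rw [this]
  exact hV.map _

lemma exists_pow_le_of_ne_bot [IsDomain R] [IsLocalRing R] [IsNoetherianRing R]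
    (hdim : ringKrullDim R = 1) {L : Ideal R} (hL : L ≠ ⊥) :
    ∃ j, IsLocalRing.maximalIdeal R ^ j ≤ L := by
  have : Ring.KrullDimLE 1 R := by
    rw [Ring.krullDimLE_iff, hdim]; rfl
  refine Ideal.exists_pow_le_of_le_radical_of_fg ?_ (IsNoetherian.noetherian _)
  rw [Ideal.radical_eq_sInf]
  refine le_sInf ?_
  rintro p ⟨hLp, hp⟩
  have hpm := hp.isMaximal_of_ne_bot fun h => hL (le_bot_iff.1 (h ▸ hLp))
  rw [IsLocalRing.eq_maximalIdeal hpm]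

end FiniteQuotient

/-! ### Derivations that kill a parameter -/

section Derivation

variable {k : Type*} [Field k] {R : Type*} [CommRing R] [Algebra k R]

/-- Supplies the `I`-adic continuity of `D`. -/
lemma derivation_mem_pow (D : Derivation k R R) {I : Ideal R} (j : ℕ) :
    ∀ r ∈ I ^ (j + 1), D r ∈ I ^ j := by
  induction j with
  | zero => simp
  | succ j ih =>
    intro r hr
    rw [pow_succ'] at hr
    refine Submodule.mul_induction_on hr ?_ ?_
    · intro a ha b hb
      rw [D.leibniz, smul_eq_mul, smul_eq_mul]
      refine add_mem ?_ (Ideal.mul_mem_right _ _ hb)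
      rw [pow_succ']; exact Ideal.mul_mem_mul ha (ih b hb)
    · intro a b ha hb; rw [map_add]; exact add_mem ha hb

/-- The constants of a derivation. -/
def constants (D : Derivation k R R) : Subalgebra k R where
  carrier := {r | D r = 0}
  mul_mem' {a b} ha hb := by
    change D (a * b) = 0
    rw [D.leibniz, show D a = 0 from ha, show D b = 0 from hb]; simp
  add_mem' {a b} ha hb := by
    change D (a + b) = 0
    rw [map_add, show D a = 0 from ha, show D b = 0 from hb, add_zero]
  algebraMap_mem' c := D.map_algebraMap c

lemma mem_constants {D : Derivation k R R} {r : R} : r ∈ constants D ↔ D r = 0 := Iff.rfl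

/-- A derivation, viewed as linear over its constants. -/
def overConstants (D : Derivation k R R) : Derivation (constants D) R R :=
  Derivation.mk'
    { toFun := D
      map_add' := map_add D
      map_smul' := fun b r => by
        change D (b.1 * r) = b.1 * D r
        rw [D.leibniz, show D b.1 = 0 from b.2]; simp }
    fun a b => D.leibniz a b

lemma overConstants_apply (D : Derivation k R R) (r : R) : overConstants D r = D r := rfl

/-- If `p(r) = 0` with constant coefficients, then `p'(r) D r = 0`. So `D r ≠ 0` would force `p'(r)
= 0`, and repeated differentiation ends at a nonzero constant. -/
lemma derivation_eq_zero_of_isIntegral [CharZero k] [IsDomain R] (D : Derivation k R R)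
    [Algebra.IsIntegral (constants D) R] (r : R) : D r = 0 := by
  have : CharZero R := charZero_of_injective_algebraMap (algebraMap k R).injective
  have : CharZero (constants D) := charZero_of_injective_algebraMap
    (algebraMap k (constants D)).injective
  by_contra hr
  have H : ∀ m : ℕ, ∀ p : Polynomial (constants D), p.natDegree = m → p ≠ 0 →
      Polynomial.aeval r p ≠ 0 := by
    intro m
    induction m with
    | zero =>
      intro p hp hp0 h
      rw [Polynomial.eq_C_of_natDegree_eq_zero hp] at h hp0
      rw [Polynomial.aeval_C] at h
      refine hp0 ?_
      rw [(Subtype.ext h : p.coeff 0 = 0), map_zero]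
    | succ m ih =>
      intro p hp hp0 h
      have h1 := (overConstants D).map_aeval p r
      rw [h, map_zero, overConstants_apply, smul_eq_mul] at h1
      refine ih (Polynomial.derivative p) ?_ ?_ ((mul_eq_zero.1 h1.symm).resolve_right hr)
      · rw [Polynomial.natDegree_derivative, hp]; rfl
      · intro h0
        have := Polynomial.derivative_eq_zero.1 h0
        omega
  obtain ⟨p, hp, hpr⟩ := Algebra.IsIntegral.isIntegral (R := constants D) r
  exact H _ p rfl hp.ne_zero hpr

/-- A derivation of a complete local domain of characteristic zero that kills a parameter is
zero. -/
lemma derivation_eq_zero_of_apply_eq_zero [CharZero k] [IsDomain R] [IsNoetherianRing R]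
    {I : Ideal R} [IsAdicComplete I R] (hk : ∀ r : R, ∃ c : k, r - algebraMap k R c ∈ I)
    {x : R} (hxI : x ∈ I) {j : ℕ} (hj : I ^ j ≤ Ideal.span {x}) (D : Derivation k R R)
    (hD : D x = 0) : D = 0 := by
  obtain ⟨V, hV, hVj⟩ := exists_fg_sup_pow_eq_top hk j
  obtain ⟨d, g, hg⟩ := Submodule.fg_iff_exists_fin_generating_family.1 hV
  have hstep : ∀ r : R, ∃ (c : Fin d → k) (ρ : R), r = ∑ i, c i • g i + x * ρ := by
    intro r
    obtain ⟨v, hv, w, hw, hvw⟩ := Submodule.mem_sup.1 (hVj.ge (Submodule.mem_top (x := r)))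
    rw [← hg] at hv
    obtain ⟨c, hc⟩ := (Submodule.mem_span_range_iff_exists_fun k).1 hv
    obtain ⟨ρ, hρ⟩ := Ideal.mem_span_singleton.1 (hj hw)
    exact ⟨c, ρ, by rw [hc, ← hρ, hvw]⟩
  choose c ρ hcρ using hstep
  -- Iterating `r = ∑ cᵢ gᵢ + x ρ` writes `r` as a combination of the `gᵢ` whose coefficients are
  -- limits `bᵢ` of polynomials in `x` over `k`. By continuity `D` kills these limits.
  have hfin : Module.Finite (constants D) R := by
    refine Module.Finite.of_fg_top ?_
    refine Submodule.fg_iff_exists_fin_generating_family.2 ⟨d, g, ?_⟩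
    rw [eq_top_iff]
    rintro r -
    let S : Fin d → ℕ → R := fun i N => ∑ l ∈ Finset.range N, c (ρ^[l] r) i • x ^ l
    have hS : ∀ N, r = ∑ i, S i N * g i + x ^ N * ρ^[N] r := by
      intro N
      induction N with
      | zero => simp [S]
      | succ N ih =>
        have e1 : ∀ i, S i (N + 1) = S i N + c (ρ^[N] r) i • x ^ N :=
          fun i => Finset.sum_range_succ _ _
        have e2 := hcρ (ρ^[N] r)
        rw [Function.iterate_succ_apply']
        calc r = ∑ i, S i N * g i + x ^ N * ρ^[N] r := ih
          _ = ∑ i, S i N * g i + x ^ N * (∑ i, c (ρ^[N] r) i • g i + x * ρ (ρ^[N] r)) := by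
            rw [← e2]
          _ = _ := by
            simp only [e1, add_mul, Finset.sum_add_distrib, mul_add, Finset.mul_sum]
            rw [pow_succ, mul_assoc, ← add_assoc]
            congr 2
            refine Finset.sum_congr rfl fun i _ => ?_
            simp [Algebra.smul_def]; ring
    have hcauchy : ∀ i, ∃ b, ∀ N, S i N ≡ b [SMOD (I ^ N • ⊤ : Submodule R R)] := by
      intro i
      refine IsPrecomplete.prec' (I := I) _ fun {m N} hmN => ?_
      rw [SModEq.sub_mem, smul_eq_mul, Ideal.mul_top, ← neg_mem_iff, neg_sub]
      have : S i N - S i m = ∑ l ∈ Finset.Ico m N, c (ρ^[l] r) i • x ^ l :=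
        (Finset.sum_Ico_eq_sub _ hmN).symm
      rw [this]
      refine sum_mem fun l hl => ?_
      rw [Algebra.smul_def]
      exact Ideal.mul_mem_left _ _ (Ideal.pow_le_pow_right (Finset.mem_Ico.1 hl).1
        (Ideal.pow_mem_pow hxI l))
    choose b hb using hcauchy
    have hb' : ∀ i N, S i N - b i ∈ I ^ N := fun i N => by
      have := SModEq.sub_mem.1 (hb i N)
      rwa [smul_eq_mul, Ideal.mul_top] at this
    have hH : ∀ a : R, (∀ N, a ∈ I ^ N) → a = 0 := fun a ha =>
      IsHausdorff.haus (I := I) inferInstance a fun N => by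
        rw [SModEq.zero, smul_eq_mul, Ideal.mul_top]; exact ha N
    have hbD : ∀ i, b i ∈ constants D := by
      intro i
      rw [mem_constants]
      refine hH _ fun N => ?_
      have h1 : D (S i (N + 1)) = 0 := by
        simp [S, map_sum, D.leibniz_pow, hD]
      have h2 := derivation_mem_pow D N _ (hb' i (N + 1))
      rwa [map_sub, h1, zero_sub, neg_mem_iff] at h2
    have hr : r = ∑ i, (⟨b i, hbD i⟩ : constants D) • g i := by
      rw [← sub_eq_zero]
      refine hH _ fun N => ?_
      have e : r - ∑ i, (⟨b i, hbD i⟩ : constants D) • g i =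
          ∑ i, (S i N - b i) * g i + x ^ N * ρ^[N] r := by
        have h0 : ∑ i, (⟨b i, hbD i⟩ : constants D) • g i = ∑ i, b i * g i := rfl
        rw [h0]
        nth_rewrite 1 [hS N]
        simp only [sub_mul, Finset.sum_sub_distrib]; ring
      rw [e]
      exact add_mem (sum_mem fun i _ => Ideal.mul_mem_right _ _ (hb' i N))
        (Ideal.mul_mem_right _ _ (Ideal.pow_mem_pow hxI N))
    rw [hr]
    exact sum_mem fun i _ => Submodule.smul_mem _ _ (Submodule.subset_span ⟨i, rfl⟩)
  have : Algebra.IsIntegral (constants D) R := Algebra.IsIntegral.of_finite _ _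
  ext r
  exact derivation_eq_zero_of_isIntegral D r

end Derivation

end Berger

namespace Berger

/-! ### Torsion-free modules and their functionals -/

section Torsionless

variable {R : Type*} [CommRing R] [IsDomain R] {M : Type*} [AddCommGroup M] [Module R M]

/-- A finitely generated torsion-free module over a domain is torsionless. -/
lemma exists_dual_apply_ne_zero [Module.Finite R M] (hM : Submodule.torsion R M = ⊥) {m : M}
    (hm : m ≠ 0) : ∃ φ : M →ₗ[R] R, φ m ≠ 0 := by
  let K := FractionRing R
  let T := LocalizedModule (nonZeroDivisors R) M
  let ι : M →ₗ[R] T := LocalizedModule.mkLinearMap (nonZeroDivisors R) M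
  have hι : ι m ≠ 0 := by
    intro h
    obtain ⟨c, hc⟩ := (IsLocalizedModule.eq_zero_iff (nonZeroDivisors R) ι).1 h
    have : m ∈ Submodule.torsion R M := (Submodule.mem_torsion_iff m).2 ⟨c, hc⟩
    rw [hM] at this
    exact hm this
  let _ : Module K T := inferInstanceAs
    (Module (Localization (nonZeroDivisors R)) (LocalizedModule (nonZeroDivisors R) M))
  have : IsScalarTower R K T := inferInstanceAs (IsScalarTower R
    (Localization (nonZeroDivisors R)) (LocalizedModule (nonZeroDivisors R) M))
  obtain ⟨ψ, hψ⟩ : ∃ ψ : Module.Dual K T, ψ (ι m) ≠ 0 := by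
    by_contra! h
    exact hι ((Module.forall_dual_apply_eq_zero_iff K (ι m)).1 h)
  let ψ' : M →ₗ[R] K := ψ.restrictScalars R ∘ₗ ι
  obtain ⟨s, hs⟩ := Module.Finite.fg_top (R := R) (M := M)
  classical
  -- A functional over the fraction field becomes `R`-valued once the denominators on a finite
  -- generating set are cleared.
  obtain ⟨b, hb⟩ := IsLocalization.exist_integer_multiples_of_finset (nonZeroDivisors R)
    (s.image ψ')
  let ι' : R →ₗ[R] K := Algebra.linearMap R K
  have hι' : Function.Injective ι' := IsFractionRing.injective R K
  have hrange : ∀ a, ((b : R) • ψ') a ∈ LinearMap.range ι' := by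
    intro a
    have : (⊤ : Submodule R M) ≤ (LinearMap.range ι').comap ((b : R) • ψ') := by
      rw [← hs, Submodule.span_le]
      intro a ha
      obtain ⟨r, hr⟩ := hb (ψ' a) (Finset.mem_image_of_mem _ ha)
      exact ⟨r, hr⟩
    exact this trivial
  let φ : M →ₗ[R] R := (LinearEquiv.ofInjective ι' hι').symm.toLinearMap ∘ₗ
    LinearMap.codRestrict _ ((b : R) • ψ') hrange
  refine ⟨φ, fun h => ?_⟩
  have h1 : (LinearMap.codRestrict _ ((b : R) • ψ') hrange) m = 0 :=
    (LinearEquiv.ofInjective ι' hι').symm.map_eq_zero_iff.1 h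
  have h2 : (b : R) • ψ' m = 0 := congrArg Subtype.val h1
  rcases smul_eq_zero.1 h2 with h3 | h3
  · exact nonZeroDivisors.ne_zero b.2 h3
  · exact hψ h3

/-- A finitely generated torsion-free module all of whose functionals are determined by their value
at one element is isomorphic to an ideal. -/
lemma exists_injective_of_dual_determined [Module.Finite R M] (hM : Submodule.torsion R M = ⊥)
    (δ : M) (hδ : ∀ φ : M →ₗ[R] R, φ δ = 0 → φ = 0) :
    ∃ φ : M →ₗ[R] R, Function.Injective φ := by
  by_cases h : ∃ φ : M →ₗ[R] R, φ δ ≠ 0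
  · obtain ⟨φ, hφ⟩ := h
    refine ⟨φ, (injective_iff_map_eq_zero φ).2 fun m hm => ?_⟩
    by_contra hm0
    obtain ⟨ψ, hψ⟩ := exists_dual_apply_ne_zero hM hm0
    -- This combination vanishes at `δ`, hence everywhere. At `m`, where `φ` vanishes, it gives `φ δ
    -- * ψ m = 0`.
    have h1 := hδ (φ δ • ψ - ψ δ • φ) (by simp [mul_comm])
    have h2 := LinearMap.congr_fun h1 m
    simp [hm, hφ, hψ] at h2
  · push Not at h
    refine ⟨0, (injective_iff_map_eq_zero _).2 fun m _ => ?_⟩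
    by_contra hm0
    obtain ⟨ψ, hψ⟩ := exists_dual_apply_ne_zero hM hm0
    exact hψ (by rw [hδ ψ (h ψ)]; rfl)

end Torsionless

/-! ### Length of an ideal modulo `x` -/

section Length

variable {k : Type*} [Field k] {R : Type*} [CommRing R] [IsDomain R] [Algebra k R]
  {M : Type*} [AddCommGroup M] [Module R M] [Module k M] [IsScalarTower k R M]

/-- If `0 → U → Q → W → 0` is exact, then `dim Q = dim U + dim W`. -/
lemma finrank_eq_add_of_exact {U Q W : Type*} [AddCommGroup U] [Module k U] [AddCommGroup Q]
    [Module k Q] [AddCommGroup W] [Module k W] [Module.Finite k Q] {f : U →ₗ[k] Q}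
    {g : Q →ₗ[k] W} (hf : Function.Injective f) (hfg : Function.Exact f g)
    (hg : Function.Surjective g) :
    Module.finrank k Q = Module.finrank k U + Module.finrank k W := by
  have h1 := LinearMap.finrank_range_add_finrank_ker g
  rw [LinearMap.range_eq_top.2 hg, finrank_top, LinearMap.exact_iff.1 hfg,
    LinearMap.finrank_range_of_inj hf] at h1
  omega

/-- For a nonzero ideal `L ≅ M`, compute `dim R ⧸ xL` twice: from `0 → R ⧸ L → R ⧸ xL → R ⧸ xR → 0`,
whose first map is multiplication by `x`, and from `0 → L ⧸ xL → R ⧸ xL → R ⧸ L → 0`. The terms `dim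
R ⧸ L` cancel. -/
lemma finite_and_finrank_quotient_smul_le {x : R} (hx : x ≠ 0)
    [Module.Finite k (R ⧸ Ideal.span {x})]
    (φ : M →ₗ[R] R) (hφ : Function.Injective φ)
    (hfin : LinearMap.range φ ≠ ⊥ → Module.Finite k (R ⧸ LinearMap.range φ)) :
    Module.Finite k (M ⧸ LinearMap.range (LinearMap.lsmul R M x)) ∧
    Module.finrank k (M ⧸ LinearMap.range (LinearMap.lsmul R M x)) ≤
      Module.finrank k (R ⧸ Ideal.span {x}) := by
  by_cases hbot : LinearMap.range φ = ⊥
  · have : Subsingleton M := by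
      refine ⟨fun a b => hφ ?_⟩
      have h : ∀ a, φ a = 0 := fun a => by
        have : φ a ∈ LinearMap.range φ := ⟨a, rfl⟩
        rwa [hbot] at this
      rw [h, h]
    have : Subsingleton (M ⧸ LinearMap.range (LinearMap.lsmul R M x)) :=
      (Submodule.mkQ_surjective _).subsingleton
    exact ⟨inferInstance, by rw [Module.finrank_zero_of_subsingleton]; exact Nat.zero_le _⟩
  have := hfin hbot
  let μ : R →ₗ[R] R := LinearMap.lsmul R R x
  let L : Ideal R := LinearMap.range φ
  let N : Ideal R := Submodule.map μ L
  let f₁ : (R ⧸ L) →ₗ[R] (R ⧸ N) := L.mapQ N μ (Submodule.le_comap_map μ L)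
  have hNx : N ≤ Ideal.span {x} := by
    rintro _ ⟨a, -, rfl⟩
    exact Ideal.mem_span_singleton.2 ⟨a, rfl⟩
  have hNL : N ≤ L := by
    rintro _ ⟨a, ha, rfl⟩
    exact Ideal.mul_mem_left _ _ ha
  let g₁ : (R ⧸ N) →ₗ[R] (R ⧸ Ideal.span {x}) := Submodule.factor hNx
  let g₂ : (R ⧸ N) →ₗ[R] (R ⧸ L) := Submodule.factor hNL
  let f₂ : (M ⧸ LinearMap.range (LinearMap.lsmul R M x)) →ₗ[R] (R ⧸ N) :=
    Submodule.mapQ _ N φ (by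
      rintro _ ⟨a, rfl⟩
      exact ⟨φ a, ⟨a, rfl⟩, by simp [μ]⟩)
  have hf₁ : Function.Injective f₁ := by
    refine (injective_iff_map_eq_zero f₁).2 fun a ha => ?_
    obtain ⟨a, rfl⟩ := Submodule.Quotient.mk_surjective _ a
    obtain ⟨b, hb, hab⟩ := (Submodule.Quotient.mk_eq_zero N).1 ha
    have : b = a := mul_left_cancel₀ hx hab
    exact (Submodule.Quotient.mk_eq_zero L).2 (this ▸ hb)
  have hf₂ : Function.Injective f₂ := by
    refine (injective_iff_map_eq_zero f₂).2 fun a ha => ?_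
    obtain ⟨a, rfl⟩ := Submodule.Quotient.mk_surjective _ a
    obtain ⟨_, ⟨b, rfl⟩, hab⟩ := (Submodule.Quotient.mk_eq_zero N).1 ha
    refine (Submodule.Quotient.mk_eq_zero _).2 ⟨b, hφ ?_⟩
    rw [← hab]; simp [μ]
  have hg₁ : Function.Surjective g₁ := Submodule.factor_surjective hNx
  have hg₂ : Function.Surjective g₂ := Submodule.factor_surjective hNL
  have he₁ : Function.Exact f₁ g₁ := by
    intro a
    obtain ⟨a, rfl⟩ := Submodule.Quotient.mk_surjective _ a
    constructor
    · intro h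
      obtain ⟨b, rfl⟩ := Ideal.mem_span_singleton.1 ((Submodule.Quotient.mk_eq_zero _).1 h)
      exact ⟨Submodule.Quotient.mk b, rfl⟩
    · rintro ⟨b, hb⟩
      obtain ⟨b, rfl⟩ := Submodule.Quotient.mk_surjective _ b
      rw [← hb]
      exact (Submodule.Quotient.mk_eq_zero _).2 (Ideal.mem_span_singleton.2 ⟨b, rfl⟩)
  have he₂ : Function.Exact f₂ g₂ := by
    intro a
    obtain ⟨a, rfl⟩ := Submodule.Quotient.mk_surjective _ a
    constructor
    · intro h
      obtain ⟨b, rfl⟩ := (Submodule.Quotient.mk_eq_zero L).1 h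
      exact ⟨Submodule.Quotient.mk b, rfl⟩
    · rintro ⟨b, hb⟩
      obtain ⟨b, rfl⟩ := Submodule.Quotient.mk_surjective _ b
      rw [← hb]
      exact (Submodule.Quotient.mk_eq_zero L).2 ⟨b, rfl⟩
  have hQ : Module.Finite k (R ⧸ N) := by
    have h1 : Module.Finite k (LinearMap.range (f₁.restrictScalars k)) := inferInstance
    have h2 : Module.Finite k ((R ⧸ N) ⧸ LinearMap.range (f₁.restrictScalars k)) := by
      have hker : LinearMap.ker (g₁.restrictScalars k) = LinearMap.range (f₁.restrictScalars k) :=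
        (LinearMap.exact_iff (f := f₁.restrictScalars k) (g := g₁.restrictScalars k)).1 he₁
      rw [← hker]
      exact Module.Finite.equiv ((g₁.restrictScalars k).quotKerEquivOfSurjective hg₁).symm
    exact Module.Finite.of_submodule_quotient (LinearMap.range (f₁.restrictScalars k))
  have e₁ := finrank_eq_add_of_exact (f := f₁.restrictScalars k) (g := g₁.restrictScalars k)
    hf₁ he₁ hg₁
  have e₂ := finrank_eq_add_of_exact (f := f₂.restrictScalars k) (g := g₂.restrictScalars k)
    hf₂ he₂ hg₂
  exact ⟨Module.Finite.of_injective (f₂.restrictScalars k) hf₂, by omega⟩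

end Length

end Berger

namespace Berger

open MvPowerSeries

/-! ### The trace form of `R ⧸ xR` -/

section Trace

/-- If `R` is a Gorenstein local domain and `R ⧸ I`, `I = x R`, is finite-dimensional, then it has a
nondegenerate trace form. -/
lemma exists_trace {k : Type*} [Field k] {R : Type*} [CommRing R] [Algebra k R] [IsLocalRing R]
    [IsNoetherianRing R] [IsDomain R] (hGor : IsGorensteinLocal R) {x : R} (hx : x ≠ 0)
    (hxm : x ∈ IsLocalRing.maximalIdeal R) {I : Ideal R} (hI : I = Ideal.span {x})
    [Module.Finite k (R ⧸ I)] :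
    ∃ σ : (R ⧸ I) →ₗ[k] k, ∀ a, (∀ b, σ (a * b) = 0) → a = 0 := by
  have : IsArtinian R (R ⧸ I) := isArtinian_of_tower k inferInstance
  have : Nontrivial (R ⧸ I) := by
    refine Ideal.Quotient.nontrivial_iff.2 fun h => ?_
    have : (1 : R) ∈ IsLocalRing.maximalIdeal R := by
      refine (Ideal.span_singleton_le_iff_mem _).2 hxm ?_
      rw [← hI, h]; trivial
    exact (IsLocalRing.maximalIdeal.isMaximal R).ne_top ((Ideal.eq_top_iff_one _).2 this)
  have hsoc : ∀ s t : R ⧸ I, s ≠ 0 → (∀ r ∈ IsLocalRing.maximalIdeal R, r • s = 0) →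
      (∀ r ∈ IsLocalRing.maximalIdeal R, r • t = 0) → ∃ r : R, t = r • s := by
    rw [← range_mulMap] at hI
    subst hI
    exact fun s t => exists_smul_eq_of_mem_socle hGor hx s t
  -- Every nonzero element has a nonzero multiple in the socle. The socle being generated by any of
  -- its nonzero elements, a functional that is nonzero at one socle element is nonzero on every
  -- nonzero ideal.
  have hatom : ∀ a : R ⧸ I, a ≠ 0 → ∃ r : R, r • a ≠ 0 ∧
      ∀ c ∈ IsLocalRing.maximalIdeal R, c • r • a = 0 := by
    intro a ha
    obtain ⟨S, hS, hSa⟩ := (eq_bot_or_exists_atom_le (Submodule.span R {a})).resolve_left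
      (by simpa using ha)
    have hsimple : IsSimpleModule R S := isSimpleModule_iff_isAtom.2 hS
    obtain ⟨m, hm, ⟨e⟩⟩ := isSimpleModule_iff_quot_maximal.1 hsimple
    obtain ⟨s, hs, hs0⟩ := Submodule.exists_mem_ne_zero_of_ne_bot hS.1
    obtain ⟨r, rfl⟩ := Submodule.mem_span_singleton.1 (hSa hs)
    refine ⟨r, hs0, fun c hc => ?_⟩
    rw [← IsLocalRing.eq_maximalIdeal hm] at hc
    have h1 : c • (⟨r • a, hs⟩ : S) = 0 := by
      apply e.injective
      rw [map_smul, map_zero]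
      obtain ⟨b, hb⟩ := Submodule.Quotient.mk_surjective _ (e ⟨r • a, hs⟩)
      rw [← hb, ← Submodule.Quotient.mk_smul, Submodule.Quotient.mk_eq_zero]
      exact Ideal.mul_mem_right _ _ hc
    exact congrArg Subtype.val h1
  obtain ⟨a₀, ha₀⟩ := exists_ne (0 : R ⧸ I)
  obtain ⟨r₀, hr₀, hs⟩ := hatom a₀ ha₀
  obtain ⟨σ, hσ⟩ : ∃ σ : Module.Dual k (R ⧸ I), σ (r₀ • a₀) ≠ 0 := by
    by_contra! h
    exact hr₀ ((Module.forall_dual_apply_eq_zero_iff k _).1 h)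
  refine ⟨σ, fun a ha => ?_⟩
  by_contra ha0
  obtain ⟨r, hr, hr'⟩ := hatom a ha0
  obtain ⟨u, hu⟩ := hsoc _ _ hr hr' hs
  refine hσ ?_
  have : r₀ • a₀ = a * Ideal.Quotient.mk I (u * r) := by
    rw [hu, smul_smul, mul_comm a]
    rfl
  rw [this, ha]

end Trace

/-! ### Minimality of the presentation -/

section Presentation

variable {k : Type*} [Field k] {R : Type*} [CommRing R] [IsLocalRing R] [Algebra k R] {n : ℕ}

lemma map_mem_maximalIdeal_iff {Φ : MvPowerSeries (Fin n) k →ₐ[k] R} (hΦ : Function.Surjective Φ)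
    {f : MvPowerSeries (Fin n) k} : Φ f ∈ IsLocalRing.maximalIdeal R ↔ f ∈ varIdeal k n := by
  constructor
  · intro h
    rw [mem_varIdeal_iff]
    by_contra h0
    have : IsUnit f := MvPowerSeries.isUnit_iff_constantCoeff.2 (isUnit_iff_ne_zero.2 h0)
    exact (IsLocalRing.mem_maximalIdeal _).1 h (this.map Φ)
  · intro h
    rw [IsLocalRing.mem_maximalIdeal]
    intro hu
    obtain ⟨b, hb⟩ := hu.exists_right_inv
    obtain ⟨g, rfl⟩ := hΦ b
    have h1 : constantCoeff (1 - f * g) = 1 := by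
      rw [map_sub, map_mul, mem_varIdeal_iff.1 h]; simp
    have h2 : IsUnit (1 - f * g) := MvPowerSeries.isUnit_iff_constantCoeff.2 (by rw [h1]; simp)
    have h3 : IsUnit (Φ (1 - f * g)) := h2.map Φ
    rw [map_sub, map_mul, hb, map_one, sub_self] at h3
    exact not_isUnit_zero h3

lemma varIdeal_pow_le_comap {Φ : MvPowerSeries (Fin n) k →ₐ[k] R} (hΦ : Function.Surjective Φ)
    (j : ℕ) : varIdeal k n ^ j ≤ (IsLocalRing.maximalIdeal R ^ j).comap Φ := by
  rw [← Ideal.map_le_iff_le_comap, Ideal.map_pow]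
  refine Ideal.pow_right_mono (Ideal.map_le_iff_le_comap.2 fun f hf => ?_) j
  exact (map_mem_maximalIdeal_iff hΦ).2 hf

lemma maximalIdeal_eq_span {Φ : MvPowerSeries (Fin n) k →ₐ[k] R} (hΦ : Function.Surjective Φ) :
    IsLocalRing.maximalIdeal R = Ideal.span (Set.range fun i => Φ (X i)) := by
  have h : Ideal.map Φ (varIdeal k n) = Ideal.span (Set.range fun i => Φ (X i)) := by
    rw [varIdeal, Ideal.map_span, ← Set.range_comp]; rfl
  rw [← h]
  apply le_antisymm
  · intro r hr
    obtain ⟨f, rfl⟩ := hΦ r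
    exact Ideal.mem_map_of_mem Φ ((map_mem_maximalIdeal_iff hΦ).1 hr)
  · exact Ideal.map_le_iff_le_comap.2 fun f hf => (map_mem_maximalIdeal_iff hΦ).2 hf

/-- A relation with a nonzero linear coefficient at `X p` expresses `Φ (X p)` through the other
generators modulo `𝔪_R²`. By Nakayama these generate `𝔪_R`, contradicting the minimality of `n`. -/
lemma ker_le_sq_of_spanFinrank_eq [CharZero k] [IsNoetherianRing R]
    {Φ : MvPowerSeries (Fin n) k →ₐ[k] R} (hΦ : Function.Surjective Φ)
    (hn : (IsLocalRing.maximalIdeal R).spanFinrank = n) : RingHom.ker Φ ≤ varIdeal k n ^ 2 := by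
  classical
  intro f hf
  have hf0 : Φ f = 0 := hf
  have hfm : f ∈ varIdeal k n := by
    rw [← map_mem_maximalIdeal_iff hΦ, hf0]; exact zero_mem _
  refine mem_sq_of_gradZero_eq_zero hfm ?_
  by_contra hne
  obtain ⟨p, hp⟩ := Function.ne_iff.1 hne
  have hp' : gradZero k n f p ≠ 0 := hp
  have hlin : f - ∑ i, gradZero k n f i • X i ∈ varIdeal k n ^ 2 := by
    refine mem_sq_of_gradZero_eq_zero (sub_mem hfm (sum_mem fun i _ => ?_)) ?_
    · rw [smul_eq_C_mul]; exact Ideal.mul_mem_left _ _ (X_mem_varIdeal i)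
    · rw [map_sub, map_sum, sub_eq_zero]
      ext j
      simp [gradZero_X, Finset.sum_apply, Pi.single_apply]
  have hsum : ∑ i, gradZero k n f i • Φ (X i) ∈ IsLocalRing.maximalIdeal R ^ 2 := by
    have := varIdeal_pow_le_comap hΦ 2 hlin
    rw [Ideal.mem_comap, map_sub, hf0, zero_sub, neg_mem_iff, map_sum] at this
    simpa only [map_smul] using this
  let N : Ideal R := Ideal.span ((fun i => Φ (X i)) '' {p}ᶜ)
  have hle : IsLocalRing.maximalIdeal R ≤ N := by
    refine Submodule.le_of_le_smul_of_le_jacobson_bot (I := IsLocalRing.maximalIdeal R)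
      (IsNoetherian.noetherian _) (IsLocalRing.maximalIdeal_le_jacobson _) ?_
    rw [smul_eq_mul, ← sq]
    nth_rewrite 1 [maximalIdeal_eq_span hΦ]
    refine Ideal.span_le.2 ?_
    rintro _ ⟨i, rfl⟩
    by_cases hi : i = p
    · subst hi
      have h1 : gradZero k n f i • Φ (X i) ∈ N ⊔ IsLocalRing.maximalIdeal R ^ 2 := by
        rw [← Finset.add_sum_erase _ _ (Finset.mem_univ i)] at hsum
        have h2 : ∑ j ∈ Finset.univ.erase i, gradZero k n f j • Φ (X j) ∈ N := by
          refine sum_mem fun j hj => ?_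
          rw [Algebra.smul_def]
          exact Ideal.mul_mem_left _ _ (Ideal.subset_span ⟨j, Finset.ne_of_mem_erase hj, rfl⟩)
        have h3 := sub_mem (Submodule.mem_sup_right (S := N) hsum)
          (Submodule.mem_sup_left (T := IsLocalRing.maximalIdeal R ^ 2) h2)
        rwa [add_sub_cancel_right] at h3
      have h4 := Ideal.mul_mem_left _ (algebraMap k R (gradZero k n f i)⁻¹) h1
      rwa [← Algebra.smul_def, inv_smul_smul₀ hp'] at h4
    · exact Submodule.mem_sup_left (Ideal.subset_span ⟨i, hi, rfl⟩)
  have hN : IsLocalRing.maximalIdeal R = N := by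
    refine le_antisymm hle ?_
    rw [maximalIdeal_eq_span hΦ]
    exact Ideal.span_mono (Set.image_subset_range _ _)
  have h1 : (IsLocalRing.maximalIdeal R).spanFinrank ≤
      ((fun i => Φ (X i)) '' ({p}ᶜ : Set (Fin n))).ncard := by
    rw [hN]
    exact Submodule.spanFinrank_span_le_ncard_of_finite (Set.toFinite _)
  have h2 := Set.ncard_image_le (f := fun i => Φ (X i)) (Set.toFinite ({p}ᶜ : Set (Fin n)))
  have h3 := Set.ncard_add_ncard_compl ({p} : Set (Fin n))
  rw [Set.ncard_singleton, Nat.card_eq_fintype_card, Fintype.card_fin] at h3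
  omega

end Presentation

/-! ### Functionals on differentials, and reduction modulo `x` -/

section Differentials

variable {k : Type*} [Field k] {R : Type*} [CommRing R] [Algebra k R] {n : ℕ}

/-- The universal derivation `f ↦ df`, on power series. -/
noncomputable def univDeriv (Φ : MvPowerSeries (Fin n) k →ₐ[k] R) :
    MvPowerSeries (Fin n) k →ₗ[k] UnivFiniteDifferentials Φ :=
  (jacobianSubmodule Φ).mkQ.restrictScalars k ∘ₗ
    LinearMap.pi (fun i => Φ.toLinearMap ∘ₗ (pderiv k i).toLinearMap)

lemma univDeriv_apply (Φ : MvPowerSeries (Fin n) k →ₐ[k] R) (f : MvPowerSeries (Fin n) k) :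
    univDeriv Φ f = Submodule.Quotient.mk (gradient Φ f) := rfl

lemma univDeriv_mul (Φ : MvPowerSeries (Fin n) k →ₐ[k] R) (f g : MvPowerSeries (Fin n) k) :
    univDeriv Φ (f * g) = Φ f • univDeriv Φ g + Φ g • univDeriv Φ f := by
  simp only [univDeriv_apply, ← Submodule.Quotient.mk_smul, ← Submodule.Quotient.mk_add]
  congr 1
  ext i
  simp [gradient, Derivation.leibniz]

lemma univDeriv_eq_zero {Φ : MvPowerSeries (Fin n) k →ₐ[k] R} {f : MvPowerSeries (Fin n) k}
    (hf : Φ f = 0) : univDeriv Φ f = 0 :=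
  (Submodule.Quotient.mk_eq_zero _).2 (Submodule.subset_span ⟨f, hf, rfl⟩)

/-- A functional on the differentials that kills every `df` is zero. -/
lemma eq_zero_of_univDeriv {Φ : MvPowerSeries (Fin n) k →ₐ[k] R}
    {φ : UnivFiniteDifferentials Φ →ₗ[R] R} (h : ∀ f, φ (univDeriv Φ f) = 0) : φ = 0 := by
  classical
  refine Submodule.linearMap_qext _ (LinearMap.pi_ext' fun i => LinearMap.ext_ring ?_)
  have := h (X i)
  rw [univDeriv_apply] at this
  have e : gradient Φ (X i) = Pi.single i 1 := by
    ext j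
    rw [gradient, pderiv_X]
    by_cases hij : j = i
    · subst hij; simp
    · rw [Pi.single_eq_of_ne hij, Pi.single_eq_of_ne (Ne.symm hij), map_zero]
  rw [e] at this
  exact this

/-- The derivation of `R` attached to a functional on the differentials. -/
lemma exists_derivation {Φ : MvPowerSeries (Fin n) k →ₐ[k] R} (hΦ : Function.Surjective Φ)
    (φ : UnivFiniteDifferentials Φ →ₗ[R] R) :
    ∃ D : Derivation k R R, ∀ f, D (Φ f) = φ (univDeriv Φ f) := by
  let s := Function.surjInv hΦ
  have hs : ∀ r, Φ (s r) = r := Function.surjInv_eq hΦ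
  have key : ∀ f g, Φ f = Φ g → φ (univDeriv Φ f) = φ (univDeriv Φ g) := by
    intro f g h
    rw [← sub_eq_zero, ← map_sub, ← map_sub, univDeriv_eq_zero (by rw [map_sub, h, sub_self]),
      map_zero]
  let D : R →ₗ[k] R :=
    { toFun := fun r => φ (univDeriv Φ (s r))
      map_add' := fun a b => by
        rw [← map_add, ← map_add]; exact key _ _ (by rw [map_add, hs, hs, hs])
      map_smul' := fun c a => by
        have h1 : φ (univDeriv Φ (s (c • a))) = φ (univDeriv Φ (c • s a)) :=
          key _ _ (by rw [map_smul, hs, hs])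
        rw [h1, map_smul, RingHom.id_apply]
        exact (φ.restrictScalars k).map_smul c _ }
  refine ⟨Derivation.mk' D fun a b => ?_, fun f => key _ _ (hs _)⟩
  change φ (univDeriv Φ (s (a * b))) = a • φ (univDeriv Φ (s b)) + b • φ (univDeriv Φ (s a))
  rw [key (s (a * b)) (s a * s b) (by rw [map_mul, hs, hs, hs]), univDeriv_mul, map_add, map_smul,
    map_smul, hs, hs]

/-- The differentials modulo `x` surject onto the differentials of `R ⧸ x R`. -/
lemma finrank_differentials_quotient_le {Φ : MvPowerSeries (Fin n) k →ₐ[k] R}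
    (hΦ : Function.Surjective Φ) (x : R)
    [Module.Finite k (UnivFiniteDifferentials Φ ⧸
      LinearMap.range (LinearMap.lsmul R (UnivFiniteDifferentials Φ) x))] :
    Module.Finite k ((Fin n → MvPowerSeries (Fin n) k) ⧸ diffRel ((Ideal.span {x}).comap Φ)) ∧
    Module.finrank k ((Fin n → MvPowerSeries (Fin n) k) ⧸ diffRel ((Ideal.span {x}).comap Φ)) ≤
      Module.finrank k (UnivFiniteDifferentials Φ ⧸
        LinearMap.range (LinearMap.lsmul R (UnivFiniteDifferentials Φ) x)) := by
  set J : Ideal (MvPowerSeries (Fin n) k) := (Ideal.span {x}).comap Φ with hJ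
  let Φn : (Fin n → MvPowerSeries (Fin n) k) →ₗ[k] (Fin n → R) :=
    LinearMap.pi fun i => Φ.toLinearMap ∘ₗ LinearMap.proj i
  have hΦn : Function.Surjective Φn := by
    intro v
    choose u hu using fun i => hΦ (v i)
    exact ⟨u, funext hu⟩
  have hmemJ : ∀ {f : MvPowerSeries (Fin n) k}, Φ f = 0 → f ∈ J := fun {f} hf => by
    rw [hJ, Ideal.mem_comap, hf]; exact zero_mem _
  let q : (Fin n → MvPowerSeries (Fin n) k) →ₗ[k] (UnivFiniteDifferentials Φ ⧸
      LinearMap.range (LinearMap.lsmul R (UnivFiniteDifferentials Φ) x)) :=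
    (Submodule.mkQ _).restrictScalars k ∘ₗ (jacobianSubmodule Φ).mkQ.restrictScalars k ∘ₗ Φn
  have hq : Function.Surjective q :=
    (Submodule.mkQ_surjective _).comp ((Submodule.mkQ_surjective _).comp hΦn)
  have hjac : ∀ w ∈ jacobianSubmodule Φ, ∃ v ∈ diffRel J, Φn v = w := by
    intro w hw
    refine Submodule.closure_induction (p := fun w _ => ∃ v ∈ diffRel J, Φn v = w) ?_ ?_ ?_ hw
    · exact ⟨0, zero_mem _, map_zero _⟩
    · rintro _ _ _ _ ⟨v, hv, rfl⟩ ⟨v', hv', rfl⟩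
      exact ⟨v + v', add_mem hv hv', map_add _ _ _⟩
    · rintro r _ ⟨g, hg, rfl⟩
      obtain ⟨p, rfl⟩ := hΦ r
      refine ⟨p • grad k n g, Submodule.smul_mem _ _ (Submodule.mem_sup_left
        (Submodule.subset_span ⟨g, hmemJ hg, rfl⟩)), ?_⟩
      ext i
      exact map_mul Φ _ _
  -- Elements of the kernel of `Pⁿ → Ω_R ⧸ xΩ_R` are, after subtraction of a lifted Jacobian
  -- relation, vectors with entries in `J`.
  have hker : LinearMap.ker q ≤ (diffRel J).restrictScalars k := by
    intro v hv
    have hv' := (Submodule.Quotient.mk_eq_zero _).1 (LinearMap.mem_ker.1 hv)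
    obtain ⟨w, hw⟩ := hv'
    obtain ⟨w, rfl⟩ := Submodule.mkQ_surjective _ w
    obtain ⟨u, rfl⟩ := hΦn w
    have h1 : Φn v - x • Φn u ∈ jacobianSubmodule Φ := by
      rw [← Submodule.Quotient.mk_eq_zero, Submodule.Quotient.mk_sub, Submodule.Quotient.mk_smul,
        sub_eq_zero]
      exact hw.symm
    obtain ⟨v', hv', hvv'⟩ := hjac _ h1
    have h2 : v - v' ∈ diffRel J := by
      refine Submodule.mem_sup_right fun i _ => ?_
      have h3 : Φ (v' i) = Φ (v i) - x * Φ (u i) := congrFun hvv' i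
      rw [Pi.sub_apply, hJ]
      refine Ideal.mem_comap.2 ?_
      rw [map_sub, h3, sub_sub_cancel]
      exact Ideal.mul_mem_right _ _ (Ideal.mem_span_singleton_self x)
    have := add_mem h2 hv'
    rwa [sub_add_cancel] at this
  let e := q.quotKerEquivOfSurjective hq
  let π : (UnivFiniteDifferentials Φ ⧸ LinearMap.range (LinearMap.lsmul R
      (UnivFiniteDifferentials Φ) x)) →ₗ[k]
      ((Fin n → MvPowerSeries (Fin n) k) ⧸ diffRel J) :=
    (LinearMap.ker q).liftQ ((diffRel J).mkQ.restrictScalars k) (by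
      intro v hv
      exact (Submodule.Quotient.mk_eq_zero _).2 (hker hv)) ∘ₗ e.symm.toLinearMap
  have hπ : Function.Surjective π := by
    intro y
    obtain ⟨v, rfl⟩ := Submodule.mkQ_surjective _ y
    refine ⟨e (Submodule.Quotient.mk v), ?_⟩
    simp only [π, LinearMap.comp_apply, LinearEquiv.coe_coe, LinearEquiv.symm_apply_apply]
    rfl
  exact ⟨Module.Finite.of_surjective π hπ, LinearMap.finrank_le_finrank_of_surjective hπ⟩

end Differentials

end Berger

/-! ### The contradiction and the main theorem -/

namespace Berger

open MvPowerSeries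

/-- The universally finite differentials have torsion, for any presentation of a Gorenstein ring as
in `mainTheorem2`. -/
theorem torsion_ne_bot {k : Type*} [Field k] [CharZero k]
    {R : Type*} [CommRing R] [IsDomain R] [IsLocalRing R] [IsNoetherianRing R] [Algebra k R]
    [IsAdicComplete (IsLocalRing.maximalIdeal R) R]
    (hk : ∀ r : R, ∃ c : k, r - algebraMap k R c ∈ IsLocalRing.maximalIdeal R)
    (hdim : ringKrullDim R = 1) (hGor : IsGorensteinLocal R)
    {n : ℕ} (hedim : (IsLocalRing.maximalIdeal R).spanFinrank = n) (hn : 6 ≤ n)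
    {x : R} (hx0 : x ≠ 0) (hxm : x ∈ IsLocalRing.maximalIdeal R)
    (hm : IsLocalRing.maximalIdeal R ^ 6 ≤ Ideal.span {x})
    {Φ : MvPowerSeries (Fin n) k →ₐ[k] R} (hΦ : Function.Surjective Φ) :
    Submodule.torsion R (UnivFiniteDifferentials Φ) ≠ ⊥ := by
  intro htor
  obtain ⟨ξ, rfl⟩ := hΦ x
  have hfin : Module.Finite k (R ⧸ Ideal.span {Φ ξ}) := finite_quotient_of_pow_le hk hm
  have hδ : ∀ φ : UnivFiniteDifferentials Φ →ₗ[R] R, φ (univDeriv Φ ξ) = 0 → φ = 0 := by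
    intro φ hφ
    obtain ⟨D, hD⟩ := exists_derivation hΦ φ
    have hD0 := derivation_eq_zero_of_apply_eq_zero hk hxm hm D (by rw [hD, hφ])
    refine eq_zero_of_univDeriv fun f => ?_
    rw [← hD, hD0]; rfl
  obtain ⟨φ, hφ⟩ := exists_injective_of_dual_determined htor _ hδ
  obtain ⟨hfin₁, hle₁⟩ := finite_and_finrank_quotient_smul_le (k := k) hx0 φ hφ fun hbot => by
    obtain ⟨j, hj⟩ := exists_pow_le_of_ne_bot hdim hbot
    exact finite_quotient_of_pow_le hk hj
  obtain ⟨hfin₂, hle₂⟩ := finrank_differentials_quotient_le (k := k) hΦ (Φ ξ)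
  let J : Ideal (MvPowerSeries (Fin n) k) := (Ideal.span {Φ ξ}).comap Φ
  let e : (MvPowerSeries (Fin n) k ⧸ J) ≃ₐ[k] (R ⧸ Ideal.span {Φ ξ}) :=
    AlgEquiv.ofBijective (Ideal.quotientMapₐ _ Φ le_rfl)
      ⟨Ideal.quotientMap_injective, Ideal.quotientMap_surjective (H := le_rfl) hΦ⟩
  have hfin₃ : Module.Finite k (MvPowerSeries (Fin n) k ⧸ J) :=
    Module.Finite.equiv e.symm.toLinearEquiv
  obtain ⟨σ, hσ⟩ := exists_trace (k := k) hGor hx0 hxm rfl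
  have hlt := finrank_quotient_lt_finrank_differentials (J := J) hn (ξ := ξ)
    ((map_mem_maximalIdeal_iff hΦ).1 hxm) (Ideal.mem_span_singleton_self _)
    (by
      intro g hg
      obtain ⟨r, hr⟩ := Ideal.mem_span_singleton'.1 (Ideal.mem_comap.1 hg)
      obtain ⟨p, rfl⟩ := hΦ r
      -- `J` is generated by `ξ` and `ker Φ`, and the latter has no linear terms.
      have h1 : g - p * ξ ∈ varIdeal k n ^ 2 := ker_le_sq_of_spanFinrank_eq hΦ hedim (by
        rw [RingHom.mem_ker, map_sub, map_mul, hr, sub_self])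
      have h2 := Submodule.add_mem_sup (Ideal.mul_mem_left _ p (Ideal.mem_span_singleton_self ξ)) h1
      rwa [add_sub_cancel] at h2)
    (fun f hf => hm (varIdeal_pow_le_comap hΦ 6 hf))
    (σ ∘ₗ e.toLinearEquiv.toLinearMap) (by
      intro a ha
      apply e.injective
      rw [map_zero]
      refine hσ _ fun b => ?_
      obtain ⟨b, rfl⟩ := e.surjective b
      rw [← map_mul]
      exact ha b)
  have heq : Module.finrank k (MvPowerSeries (Fin n) k ⧸ J) =
      Module.finrank k (R ⧸ Ideal.span {Φ ξ}) := e.toLinearEquiv.finrank_eq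
  rw [heq] at hlt
  exact absurd (hle₂.trans hle₁) (not_le.2 hlt)

/-- A complete local ring of embedding dimension `n` with coefficient field `k` is a quotient of
`k⟦X₁, …, Xₙ⟧`. -/
theorem exists_presentation {k : Type*} [Field k] {R : Type*} [CommRing R] [IsLocalRing R]
    [IsNoetherianRing R] [Algebra k R] [IsAdicComplete (IsLocalRing.maximalIdeal R) R]
    (hk : ∀ r : R, ∃ c : k, r - algebraMap k R c ∈ IsLocalRing.maximalIdeal R)
    {n : ℕ} (hedim : (IsLocalRing.maximalIdeal R).spanFinrank = n) :
    ∃ Φ : MvPowerSeries (Fin n) k →ₐ[k] R, Function.Surjective Φ := by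
  obtain ⟨s, hs, hspan⟩ := (IsNoetherian.noetherian
    (IsLocalRing.maximalIdeal R)).exists_span_finset_card_eq_spanFinrank
  rw [hedim] at hs
  let y : Fin n → R := fun i => (s.equivFinOfCardEq hs).symm i
  have hy : Set.range y = s := by
    ext a
    constructor
    · rintro ⟨i, rfl⟩; exact ((s.equivFinOfCardEq hs).symm i).2
    · intro ha; exact ⟨s.equivFinOfCardEq hs ⟨a, ha⟩, by simp [y]⟩
  have hI : IsLocalRing.maximalIdeal R = Ideal.span (Set.range y) := by
    rw [hy]; exact hspan.symm
  have hmem : ∀ i, y i ∈ IsLocalRing.maximalIdeal R := fun i => by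
    rw [hI]; exact Ideal.subset_span ⟨i, rfl⟩
  exact ⟨evalAt hmem, evalAt_surjective hmem hI hk⟩

end Berger

theorem mainTheorem2 {k : Type*} [Field k] [IsAlgClosed k] [CharZero k]
    {R : Type*} [CommRing R] [IsDomain R] [IsLocalRing R] [IsNoetherianRing R] [Algebra k R]
    [IsAdicComplete (IsLocalRing.maximalIdeal R) R]
    (hres : Function.Bijective (algebraMap k (IsLocalRing.ResidueField R)))
    (hdim : ringKrullDim R = 1)
    (hGor : Berger.IsGorensteinLocal R)
    (n : ℕ) (hedim : (IsLocalRing.maximalIdeal R).spanFinrank = n) (hn : 6 ≤ n)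
    (x : R) (hx : Berger.IsMinimalReduction (Ideal.span {x}) (IsLocalRing.maximalIdeal R))
    (hm : IsLocalRing.maximalIdeal R ^ 6 ≤ Ideal.span {x}) :
    (∃ Φ : MvPowerSeries (Fin n) k →ₐ[k] R, Function.Surjective Φ) ∧
    ∀ Φ : MvPowerSeries (Fin n) k →ₐ[k] R, Function.Surjective Φ →
      Submodule.torsion R (Berger.UnivFiniteDifferentials Φ) ≠ ⊥ := by
  have hk : ∀ r : R, ∃ c : k, r - algebraMap k R c ∈ IsLocalRing.maximalIdeal R := by
    intro r
    obtain ⟨c, hc⟩ := hres.2 (IsLocalRing.residue R r)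
    refine ⟨c, ?_⟩
    rw [← IsLocalRing.residue_eq_zero_iff, map_sub, ← hc, sub_eq_zero,
      IsScalarTower.algebraMap_apply k R (IsLocalRing.ResidueField R)]
    rfl
  have hxm : x ∈ IsLocalRing.maximalIdeal R := hx.prop.1 (Ideal.mem_span_singleton_self x)
  -- If `x = 0`, then `𝔪_R⁶ = 0`, so `𝔪_R = 0` in the domain `R`, against `n ≥ 6`.
  have hx0 : x ≠ 0 := by
    rintro rfl
    have h1 : IsLocalRing.maximalIdeal R ^ 6 ≤ ⊥ := by simpa using hm
    have h2 : IsLocalRing.maximalIdeal R = ⊥ := eq_bot_iff.2 fun r hr =>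
      eq_zero_of_pow_eq_zero (n := 6) (h1 (Ideal.pow_mem_pow hr 6))
    rw [h2, Submodule.spanFinrank_bot] at hedim
    omega
  exact ⟨Berger.exists_presentation hk hedim, fun Φ hΦ =>
    Berger.torsion_ne_bot hk hdim hGor hedim hn hx0 hxm hm hΦ⟩
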